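/- Let $\Gamma$ be a finite simplicial graph with vertex set $V$, and let $A_\Gamma=\langle V \mid vw=wv \text{ for adjacent } v,w\rangle$ be the associated right-angled Artin group. Write $lk(v)$ for the set of vertices adjacent to $v$ and $st(v)=lk(v)\cup\{v\}$. Let $\mathrm{Out}_\ell(A_\Gamma)\le \mathrm{Out}(A_\Gamma)$ be the subgroup generated by the classes of all graph automorphisms, inversions ($v\mapsto v^{-1}$), partial conjugations ($x\mapsto vxv^{-1}$ for all $x$ in one connected component of $\Gamma\setminus st(v)$) and non-adjacent transvections ($v\mapsto vw$ where $v\ne w$ are not adjacent and $lk(v)\subseteq st(w)$); each of these fixes the generators that are not mentioned. Let $\mathbb S$ be the Salvetti complex of $\Gamma$: the cube complex with one vertex, whose oriented edges are the elements of $V^{\pm}=\{v,v^{-1}\mid v\in V\}$, and with one $k$-cube (a $k$-torus) for each set of $k$ pairwise adjacent vertices of $\Gamma$. It is aspherical with fundamental group $A_\Gamma$, so homotopy classes of homotopy equivalences $\mathbb S\to\mathbb S$ are identified with elements of $\mathrm{Out}(A_\Gamma)$. A *marked Salvetti* $\sigma=(\mathbb S,\alpha)$ is an element $\alpha\in\mathrm{Out}_\ell(A_\Gamma)$,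 where $(\mathbb S,\alpha)$ and $(\mathbb S,\alpha')$ are regarded as equal if $\alpha'\circ h_*=\alpha$ for some isomorphism of cube complexes $h:\mathbb S\to\mathbb S$. (Such isomorphisms are given, up to homotopy, by the permutations of $V^\pm$ that commute with inversion and that, together with their inverses, carry sets of edges spanning a cube to sets of edges spanning a cube.) For a conjugacy class $g$ of $A_\Gamma$, let $\ell_\sigma(g)$ be the minimal length of a word in the free group $F(V)$ representing an element of the conjugacy class $\alpha^{-1}(g)$. Let $\mathcal G_0$ be the (finite) set of conjugacy classes of $A_\Gamma$ that can be represented by words of length at most $2$, and let $\mathcal G=(g_1,g_2,\ldots)$ be any list of all conjugacy classes of $A_\Gamma$ (repetitions are allowed). The norm of $\sigma$ is $$\|\sigma\|=(\|\sigma\|_0,\|\sigma\|_1,\|\sigma\|_2,\ldots)\in\mathbb Z\times\mathbb Z^{\mathcal G},\qquad \|\sigma\|_0=\sum_{g\in\mathcal G_0}\ell_\sigma(g),\qquad \|\sigma\|_i=\ell_\sigma(g_i)\ \ (i\ge 1),$$ and norms are compared lexicographically. Then: 1. For every $N\in\mathbb Z$ there are only finitely many marked Salvettis $\sigma$ with $\|\sigma\|_0\le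 N$. 2. For every such list $\mathcal G$, the set of marked Salvettis is well-ordered by the norm: the relation $\sigma<\tau \iff \|\sigma\|<\|\tau\|$ is a well-founded strict total order on it (in particular, distinct marked Salvettis have distinct norms). -/

import Mathlib

namespace RAAG

open scoped commutatorElement

noncomputable section

/-! ### Outer automorphisms and their action on conjugacy classes -/

/-- Inner automorphisms. -/
abbrev Inn (G : Type*) [Group G] : Subgroup (MulAut G) := (MulAut.conj : G →* MulAut G).range

instance Inn.normal (G : Type*) [Group G] : (Inn G).Normal := by
  constructor
  rintro _ ⟨g, rfl⟩ φ
  refine ⟨φ g, ?_⟩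
  ext x
  simp [MulAut.mul_apply, MulAut.inv_def]

/-- The outer automorphism group `Out(G) = Aut(G) / Inn(G)`.
Multiplication in `MulAut G` is composition. -/
abbrev Out (G : Type*) [Group G] : Type _ := MulAut G ⧸ Inn G

/-- The action of `Aut(G)` on the conjugacy classes of `G`. -/
def autConj (G : Type*) [Group G] : MulAut G →* Equiv.Perm (ConjClasses G) where
  toFun φ :=
    { toFun := ConjClasses.map φ.toMonoidHom
      invFun := ConjClasses.map (φ⁻¹).toMonoidHom
      left_inv := by
        intro c
        obtain ⟨a, rfl⟩ := ConjClasses.exists_rep c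
        exact congrArg ConjClasses.mk (MulAut.inv_apply_self G φ a)
      right_inv := by
        intro c
        obtain ⟨a, rfl⟩ := ConjClasses.exists_rep c
        exact congrArg ConjClasses.mk (MulAut.apply_inv_self G φ a) }
  map_one' := by
    ext c
    obtain ⟨a, rfl⟩ := ConjClasses.exists_rep c
    rfl
  map_mul' φ ψ := by
    ext c
    obtain ⟨a, rfl⟩ := ConjClasses.exists_rep c
    rfl

theorem autConj_mk {G : Type*} [Group G] (φ : MulAut G) (a : G) :
    autConj G φ (ConjClasses.mk a) = ConjClasses.mk (φ a) := rfl

/-- The action of `Out(G)` on the conjugacy classes of `G`. -/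
def outConj (G : Type*) [Group G] : Out G →* Equiv.Perm (ConjClasses G) :=
  QuotientGroup.lift (Inn G) (autConj G) (by
    rintro _ ⟨g, rfl⟩
    ext c
    obtain ⟨a, rfl⟩ := ConjClasses.exists_rep c
    rw [autConj_mk]
    exact ConjClasses.mk_eq_mk_iff_isConj.2 (isConj_iff.2 ⟨g⁻¹, by simp [mul_assoc]⟩))

variable {V : Type*} (Γ : SimpleGraph V)

/-! ### The right-angled Artin group -/

/-- The relators `[v, w]`, one for each pair of adjacent vertices. -/
def rels : Set (FreeGroup V) :=
  {r | ∃ v w : V, Γ.Adj v w ∧ r = ⁅FreeGroup.of v, FreeGroup.of w⁆}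

/-- The right-angled Artin group `A_Γ`: one generator for each vertex, and adjacent vertices
commute. -/
abbrev Artin : Type _ := PresentedGroup (rels Γ)

/-- The generator of `A_Γ` given by the vertex `v`. -/
def gen (v : V) : Artin Γ := PresentedGroup.of v

/-- The length of a conjugacy class of `A_Γ`: the minimal length of a word in the free group
`F(V)` that represents an element of the class. -/
def conjLength (c : ConjClasses (Artin Γ)) : ℕ :=
  open Classical in
  sInf {n : ℕ | ∃ w : FreeGroup V,
    ConjClasses.mk (PresentedGroup.mk (rels Γ) w) = c ∧ FreeGroup.norm w = n}

/-! ### The subgroup `Out_ℓ(A_Γ)` of long-range outer automorphisms -/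

/-- The link of a vertex. -/
def lk (v : V) : Set V := {x | Γ.Adj v x}

/-- The star of a vertex. -/
def st (v : V) : Set V := insert v (lk Γ v)

/-- Automorphisms of `A_Γ` that are induced by an automorphism of the graph. -/
def IsGraphAut (φ : MulAut (Artin Γ)) : Prop :=
  ∃ π : Γ ≃g Γ, ∀ x, φ (gen Γ x) = gen Γ (π x)

/-- Inversions: `v ↦ v⁻¹`, all other generators fixed. -/
def IsInversion (φ : MulAut (Artin Γ)) : Prop :=
  ∃ v, φ (gen Γ v) = (gen Γ v)⁻¹ ∧ ∀ x, x ≠ v → φ (gen Γ x) = gen Γ x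

/-- Partial conjugations: `x ↦ v x v⁻¹` for the vertices `x` of one connected component of
`Γ ∖ st(v)`, all other generators fixed. -/
def IsPartialConj (φ : MulAut (Artin Γ)) : Prop :=
  ∃ v, ∃ C : (Γ.induce (st Γ v)ᶜ).ConnectedComponent, ∀ x : V,
    (x ∈ Subtype.val '' C.supp → φ (gen Γ x) = gen Γ v * gen Γ x * (gen Γ v)⁻¹) ∧
    (x ∉ Subtype.val '' C.supp → φ (gen Γ x) = gen Γ x)

/-- Non-adjacent transvections: `v ↦ v w` where `lk(v) ⊆ st(w)` and `v`, `w` are distinct and not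
adjacent, all other generators fixed. -/
def IsNonadjTransvection (φ : MulAut (Artin Γ)) : Prop :=
  ∃ v w, v ≠ w ∧ ¬ Γ.Adj v w ∧ lk Γ v ⊆ st Γ w ∧
    φ (gen Γ v) = gen Γ v * gen Γ w ∧ ∀ x, x ≠ v → φ (gen Γ x) = gen Γ x

/-- `Out_ℓ(A_Γ)`: the subgroup of `Out(A_Γ)` generated by graph automorphisms, inversions, partial
conjugations and non-adjacent transvections. -/
def OutL : Subgroup (Out (Artin Γ)) :=
  Subgroup.closure ((fun φ : MulAut (Artin Γ) => (φ : Out (Artin Γ))) ''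
    {φ | IsGraphAut Γ φ ∨ IsInversion Γ φ ∨ IsPartialConj Γ φ ∨ IsNonadjTransvection Γ φ})

/-! ### Automorphisms of the Salvetti complex

The Salvetti complex `S` has one vertex. Its oriented edges form the set `V^± = V × Bool`, where
`(v, true)` is the edge `e_v` and `(v, false)` is the same edge with the opposite orientation.
For each set of pairwise adjacent vertices of `Γ`, there is exactly one cube (a torus after
identification of its faces) with these edges. -/

/-- Reversal of orientation of an oriented edge. -/
def rev (x : V × Bool) : V × Bool := (x.1, !x.2)

/-- A set of oriented edges of `S` spans a cube at the vertex of `S`, with one edge of the set in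
each direction, iff the labels are pairwise adjacent in `Γ`. -/
def SpansCube (s : Set (V × Bool)) : Prop := s.Pairwise fun x y => Γ.Adj x.1 y.1

/-- Isomorphisms of cube complexes `S → S`, given by their effect on oriented edges: permutations
of the oriented edges that commute with reversal and that carry, together with their inverses,
edges that span a cube to edges that span a cube. -/
def SalvettiAut : Subgroup (Equiv.Perm (V × Bool)) where
  carrier := {h | (∀ x, h (rev x) = rev (h x)) ∧
    ∀ s : Set (V × Bool), SpansCube Γ (h '' s) ↔ SpansCube Γ s}
  one_mem' := ⟨fun _ => rfl, fun s => by simp⟩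
  mul_mem' := by
    rintro g h ⟨hg, hg'⟩ ⟨hh, hh'⟩
    refine ⟨fun x => by simp [Equiv.Perm.mul_apply, hh, hg], fun s => ?_⟩
    rw [Equiv.Perm.coe_mul, Set.image_comp, hg', hh']
  inv_mem' := by
    rintro h ⟨hh, hh'⟩
    refine ⟨fun x => ?_, fun s => ?_⟩
    · apply h.injective
      rw [hh]
      simp
    · rw [← hh' (⇑h⁻¹ '' s), ← Set.image_comp]
      simp

/-- The element of `A_Γ = π₁(S)` represented by an oriented edge, which is a loop in `S`. -/
def edgeElt (x : V × Bool) : Artin Γ := PresentedGroup.mk (rels Γ) (FreeGroup.mk [x])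

theorem edgeElt_true (v : V) : edgeElt Γ (v, true) = gen Γ v := rfl

theorem edgeElt_rev (x : V × Bool) : edgeElt Γ (rev x) = (edgeElt Γ x)⁻¹ := by
  rw [edgeElt, edgeElt, ← map_inv, FreeGroup.inv_mk]
  rfl

theorem edgeElt_commute {x y : V × Bool} (h : Γ.Adj x.1 y.1) :
    Commute (edgeElt Γ x) (edgeElt Γ y) := by
  have key : ∀ v w : V, Γ.Adj v w → Commute (edgeElt Γ (v, true)) (edgeElt Γ (w, true)) := by
    intro v w hvw
    rw [← commutatorElement_eq_one_iff_commute]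
    have : ⁅edgeElt Γ (v, true), edgeElt Γ (w, true)⁆ =
        PresentedGroup.mk (rels Γ) ⁅FreeGroup.of v, FreeGroup.of w⁆ := by
      rw [map_commutatorElement]
      rfl
    rw [this]
    exact PresentedGroup.one_of_mem ⟨v, w, hvw, rfl⟩
  have hf : ∀ v : V, edgeElt Γ (v, false) = (edgeElt Γ (v, true))⁻¹ :=
    fun v => edgeElt_rev Γ (v, true)
  obtain ⟨v, b⟩ := x
  obtain ⟨w, c⟩ := y
  have := key v w h
  cases b <;> cases c
  · rw [hf, hf]
    exact this.inv_inv
  · rw [hf]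
    exact this.inv_left
  · rw [hf]
    exact this.inv_right
  · exact this

theorem SalvettiAut.adj (h : SalvettiAut Γ) {x y : V × Bool} (hxy : Γ.Adj x.1 y.1) :
    Γ.Adj (h.1 x).1 (h.1 y).1 := by
  have hs : SpansCube Γ {x, y} := by
    rintro a (rfl | rfl) b (rfl | rfl) hab
    · exact absurd rfl hab
    · exact hxy
    · exact hxy.symm
    · exact absurd rfl hab
  have hne : x ≠ y := fun e => Γ.loopless.irrefl _ (e ▸ hxy)
  exact (h.2.2 {x, y}).2 hs ⟨x, by simp, rfl⟩ ⟨y, by simp, rfl⟩ (h.1.injective.ne hne)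

/-- The endomorphism of `A_Γ = π₁(S)` induced by an isomorphism `S → S`. -/
def indHom (h : SalvettiAut Γ) : Artin Γ →* Artin Γ :=
  PresentedGroup.toGroup (f := fun v => edgeElt Γ (h.1 (v, true))) (by
    rintro _ ⟨v, w, hvw, rfl⟩
    rw [map_commutatorElement, FreeGroup.lift_apply_of, FreeGroup.lift_apply_of,
      commutatorElement_eq_one_iff_commute]
    exact edgeElt_commute Γ (SalvettiAut.adj Γ h hvw))

theorem indHom_edgeElt (h : SalvettiAut Γ) (x : V × Bool) :
    indHom Γ h (edgeElt Γ x) = edgeElt Γ (h.1 x) := by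
  have key : ∀ v : V, indHom Γ h (edgeElt Γ (v, true)) = edgeElt Γ (h.1 (v, true)) :=
    fun v => PresentedGroup.toGroup.of _
  obtain ⟨v, b⟩ := x
  cases b
  · have e : ((v, false) : V × Bool) = rev (v, true) := rfl
    rw [e, edgeElt_rev, map_inv, key, h.2.1, edgeElt_rev]
  · exact key v

theorem indHom_comp (g h : SalvettiAut Γ) (a : Artin Γ) :
    indHom Γ g (indHom Γ h a) = indHom Γ (g * h) a := by
  have : (indHom Γ g).comp (indHom Γ h) = indHom Γ (g * h) := by
    apply PresentedGroup.ext
    intro v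
    change indHom Γ g (indHom Γ h (edgeElt Γ (v, true))) = indHom Γ (g * h) (edgeElt Γ (v, true))
    simp only [indHom_edgeElt]
    rfl
  exact DFunLike.congr_fun this a

theorem indHom_one (a : Artin Γ) : indHom Γ 1 a = a := by
  have : indHom Γ 1 = MonoidHom.id _ := by
    apply PresentedGroup.ext
    intro v
    exact indHom_edgeElt Γ 1 (v, true)
  exact DFunLike.congr_fun this a

/-- The automorphism of `A_Γ = π₁(S)` induced by an isomorphism `S → S`. -/
def indAut : SalvettiAut Γ →* MulAut (Artin Γ) where
  toFun h :=
    { toFun := indHom Γ h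
      invFun := indHom Γ h⁻¹
      left_inv := fun a => by rw [indHom_comp, inv_mul_cancel, indHom_one]
      right_inv := fun a => by rw [indHom_comp, mul_inv_cancel, indHom_one]
      map_mul' := map_mul _ }
  map_one' := by
    ext a
    exact indHom_one Γ a
  map_mul' g h := by
    ext a
    exact (indHom_comp Γ g h a).symm

theorem mk_eq_prod (L : List (V × Bool)) :
    PresentedGroup.mk (rels Γ) (FreeGroup.mk L) = (L.map (edgeElt Γ)).prod := by
  induction L with
  | nil => exact map_one _
  | cons x L ih =>
    have e : FreeGroup.mk (x :: L) = FreeGroup.mk [x] * FreeGroup.mk L := by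
      rw [FreeGroup.mul_mk]
      rfl
    rw [e, map_mul, ih, List.map_cons, List.prod_cons]
    rfl

theorem conjLength_nonempty (c : ConjClasses (Artin Γ)) :
    open Classical in
    {n : ℕ | ∃ w : FreeGroup V,
      ConjClasses.mk (PresentedGroup.mk (rels Γ) w) = c ∧ FreeGroup.norm w = n}.Nonempty := by
  obtain ⟨a, rfl⟩ := ConjClasses.exists_rep c
  obtain ⟨w, rfl⟩ := PresentedGroup.mk_surjective (rels Γ) a
  exact ⟨_, w, rfl, rfl⟩

theorem conjLength_indAut_le (h : SalvettiAut Γ) (c : ConjClasses (Artin Γ)) :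
    conjLength Γ (autConj _ (indAut Γ h) c) ≤ conjLength Γ c := by
  classical
  obtain ⟨w, hw, hn⟩ := Nat.sInf_mem (conjLength_nonempty Γ c)
  have hle : conjLength Γ (autConj _ (indAut Γ h) c) ≤
      FreeGroup.norm (FreeGroup.mk (w.toWord.map h.1)) := by
    refine Nat.sInf_le ⟨FreeGroup.mk (w.toWord.map h.1), ?_, by congr!⟩
    rw [← hw, autConj_mk]
    congr 1
    conv_rhs => rw [← FreeGroup.mk_toWord (x := w)]
    rw [mk_eq_prod, mk_eq_prod, map_list_prod, List.map_map, List.map_map]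
    congr 1
    apply List.map_congr_left
    intro x _
    exact (indHom_edgeElt Γ h x).symm
  refine hle.trans ((FreeGroup.norm_mk_le).trans ?_)
  rw [List.length_map]
  exact le_of_eq (Eq.trans (by unfold FreeGroup.norm; congr!) hn)

theorem conjLength_indAut (h : SalvettiAut Γ) (c : ConjClasses (Artin Γ)) :
    conjLength Γ (autConj _ (indAut Γ h) c) = conjLength Γ c := by
  refine le_antisymm (conjLength_indAut_le Γ h c) ?_
  have := conjLength_indAut_le Γ h⁻¹ (autConj _ (indAut Γ h) c)
  rwa [← Equiv.Perm.mul_apply, ← map_mul, ← map_mul, inv_mul_cancel, map_one, map_one] at this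

/-! ### Marked Salvettis and their norm -/

/-- Equivalence of marked Salvettis `(S, α)` and `(S, α')`: there is an isomorphism of cube
complexes `h : S → S` with `α' ∘ h ≃ α`. The markings are given by the elements of `Out_ℓ(A_Γ)` that
they induce; as `S` is aspherical with fundamental group `A_Γ`, homotopy classes of homotopy
equivalences `S → S` are the same as elements of `Out(A_Γ)`. -/
def markingSetoid : Setoid (OutL Γ) where
  r α α' := ∃ h : SalvettiAut Γ, (α' : Out (Artin Γ)) * (indAut Γ h : MulAut (Artin Γ)) = α
  iseqv :=
    { refl := fun α => ⟨1, by simp⟩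
      symm := by
        rintro α α' ⟨h, hh⟩
        refine ⟨h⁻¹, ?_⟩
        rw [← hh, map_inv, QuotientGroup.mk_inv, mul_inv_cancel_right]
      trans := by
        rintro α β γ ⟨h, hh⟩ ⟨k, hk⟩
        refine ⟨k * h, ?_⟩
        rw [← hh, ← hk, map_mul, QuotientGroup.mk_mul, mul_assoc] }

/-- The set of marked Salvettis. -/
def MarkedSalvetti : Type _ := Quotient (markingSetoid Γ)

variable {Γ}

/-- `ℓ_σ(g)` for `σ = (S, α)`: the length of the conjugacy class `α⁻¹(g)`. -/
def MarkedSalvetti.len (σ : MarkedSalvetti Γ) (g : ConjClasses (Artin Γ)) : ℕ :=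
  Quotient.lift
    (fun α : OutL Γ => conjLength Γ (outConj (Artin Γ) (α : Out (Artin Γ))⁻¹ g)) (by
      rintro α α' ⟨h, hh⟩
      rw [← hh, mul_inv_rev, map_mul, Equiv.Perm.mul_apply, ← QuotientGroup.mk_inv, ← map_inv]
      exact conjLength_indAut Γ h⁻¹ _) σ

variable (Γ)

/-- `𝒢₀`: the conjugacy classes that can be represented by words of length at most `2`. -/
def shortClasses : Set (ConjClasses (Artin Γ)) :=
  open Classical in
  {g | ∃ w : FreeGroup V, FreeGroup.norm w ≤ 2 ∧
    ConjClasses.mk (PresentedGroup.mk (rels Γ) w) = g}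

theorem shortClasses_finite [Finite V] : (shortClasses Γ).Finite := by
  classical
  refine ((List.finite_length_le (V × Bool) 2).image fun L =>
    ConjClasses.mk (PresentedGroup.mk (rels Γ) (FreeGroup.mk L))).subset ?_
  rintro g ⟨w, hw, rfl⟩
  refine ⟨w.toWord, ?_, by simp only [FreeGroup.mk_toWord]⟩
  have : FreeGroup.norm w ≤ 2 := by convert hw
  exact this

variable {Γ}

/-- `‖σ‖₀ = ∑_{g ∈ 𝒢₀} ℓ_σ(g)`. -/
def MarkedSalvetti.norm0 [Finite V] (σ : MarkedSalvetti Γ) : ℤ :=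
  ∑ g ∈ (shortClasses_finite Γ).toFinset, (σ.len g : ℤ)

/-- The norm `‖σ‖ = (‖σ‖₀, ℓ_σ(g₁), ℓ_σ(g₂), …)` with respect to a list `(g₁, g₂, …)` of conjugacy
classes, with values ordered lexicographically. -/
def MarkedSalvetti.norm [Finite V] (e : ℕ → ConjClasses (Artin Γ)) (σ : MarkedSalvetti Γ) :
    ℤ ×ₗ Lex (ℕ → ℤ) :=
  toLex (σ.norm0, toLex fun i => (σ.len (e i) : ℤ))

end

end RAAG

namespace RAAG

/-! ### Word length -/

section Length

variable {V : Type*} {Γ : SimpleGraph V}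

/-! The geometry is that of walls in the Cayley graph of A_Γ. A ping-pong action on ℤ^V detects the
first letters of an element, and hence word length. Every edge has a wall with two half-spaces, and
`len (p⁻¹ * q)` counts the half-spaces that contain q but not p. Conjugation by a letter a changes
the length of g by 0 or ±2. Let K be the half-space of a at the base point. The length drops exactly
when g maps the complement of K into K (`shortens_halfSpace_iff`); if it rises, then g moves K off
itself (`not_leads_mul_of_gain`).

Given an automorphism φ, compose it with the conjugation that minimizes the total length of the
images φ(v). If a still shortens φ(v), then some φ(w) moves K off itself (`exists_balanced`), and
φ(vw) = φ(v)φ(w) maps K properly into itself. Every orbit of φ(vw) then has to cross walls, and this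
bounds the conjugacy length of φ(vw) from below.

There are two consequences. The walls across which φ(v) must be conjugated to become shortest are
limited by the conjugacy lengths of the φ(vw). So conjugacy lengths on words of length at most 2
bound every φ(v), leaving finitely many φ (`Balanced.len_le`). If φ preserves all conjugacy lengths,
then φ(vw) is conjugate to a word of length at most 2 that contains both a and its inverse, so it is
trivial, which is absurd. Hence every φ(v) is a letter and φ comes from an isomorphism of the
Salvetti complex (`Balanced.len_le_one`, `exists_indAut_eq`). Finite sublevel sets together with
injectivity of the norm give the well-order. -/

theorem rev_rev (a : V × Bool) : rev (rev a) = a := by simp [rev]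

theorem ne_rev (a : V × Bool) : a ≠ rev a := by
  intro h
  simpa [rev] using congrArg Prod.snd h

variable (Γ) in
/-- The element of `A_Γ` represented by a word. -/
def wordElt (l : List (V × Bool)) : Artin Γ := (l.map (edgeElt Γ)).prod

@[simp] theorem wordElt_nil : wordElt Γ [] = 1 := rfl

@[simp] theorem wordElt_cons (a : V × Bool) (l : List (V × Bool)) :
    wordElt Γ (a :: l) = edgeElt Γ a * wordElt Γ l := rfl

@[simp] theorem wordElt_append (l m : List (V × Bool)) :
    wordElt Γ (l ++ m) = wordElt Γ l * wordElt Γ m := by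
  simp [wordElt]

theorem exists_wordElt (g : Artin Γ) : ∃ l, wordElt Γ l = g := by
  classical
  obtain ⟨w, rfl⟩ := PresentedGroup.mk_surjective (rels Γ) g
  exact ⟨w.toWord, by rw [wordElt, ← mk_eq_prod, FreeGroup.mk_toWord]⟩

/-- The minimal length of a word for `g`. -/
noncomputable def len (g : Artin Γ) : ℕ := sInf {n | ∃ l, wordElt Γ l = g ∧ l.length = n}

theorem exists_geodesic (g : Artin Γ) : ∃ l, wordElt Γ l = g ∧ l.length = len g := by
  obtain ⟨l, hl⟩ := exists_wordElt g
  exact Nat.sInf_mem (s := {n | ∃ l, wordElt Γ l = g ∧ l.length = n}) ⟨_, l, hl, rfl⟩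

theorem len_wordElt_le (l : List (V × Bool)) : len (wordElt Γ l) ≤ l.length :=
  Nat.sInf_le ⟨l, rfl, rfl⟩

@[simp] theorem len_one : len (1 : Artin Γ) = 0 := Nat.le_zero.1 (len_wordElt_le [])

theorem len_mul_le (g h : Artin Γ) : len (g * h) ≤ len g + len h := by
  obtain ⟨l, rfl, hl⟩ := exists_geodesic g
  obtain ⟨m, rfl, hm⟩ := exists_geodesic h
  rw [← wordElt_append, ← hl, ← hm, ← List.length_append]
  exact len_wordElt_le _

theorem len_edgeElt_le (a : V × Bool) : len (edgeElt Γ a) ≤ 1 := by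
  simpa using len_wordElt_le (Γ := Γ) [a]

theorem len_inv_le (g : Artin Γ) : len g⁻¹ ≤ len g := by
  obtain ⟨l, rfl, hl⟩ := exists_geodesic g
  rw [← hl]
  clear hl
  induction l with
  | nil => simp
  | cons a l ih =>
    rw [wordElt_cons, mul_inv_rev, ← edgeElt_rev]
    have := len_mul_le (wordElt Γ l)⁻¹ (edgeElt Γ (rev a))
    have := len_edgeElt_le (Γ := Γ) (rev a)
    simp only [List.length_cons]
    omega

@[simp] theorem len_inv (g : Artin Γ) : len g⁻¹ = len g :=
  le_antisymm (len_inv_le g) (by simpa using len_inv_le g⁻¹)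

theorem eq_one_of_len_eq_zero {g : Artin Γ} (h : len g = 0) : g = 1 := by
  obtain ⟨l, rfl, hl⟩ := exists_geodesic g
  rw [h, List.length_eq_zero_iff] at hl
  simp [hl]

end Length

/-! ### A ping-pong action of `A_Γ` -/

section Action

variable {V : Type*} [Finite V] (Γ : SimpleGraph V)

/-- The total size of the coordinates at the vertices that are distinct from `v` and not adjacent
to `v`. -/
noncomputable def height (v : V) (x : V → ℤ) : ℤ :=
  ∑ w ∈ (Set.toFinite {w | w ≠ v ∧ ¬ Γ.Adj v w}).toFinset, |x w|

theorem height_congr {v : V} {x y : V → ℤ} (h : ∀ w, w ≠ v → ¬ Γ.Adj v w → x w = y w) :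
    height Γ v x = height Γ v y := by
  refine Finset.sum_congr rfl fun w hw => ?_
  have hw' : w ≠ v ∧ ¬ Γ.Adj v w := by simpa using hw
  rw [h w hw'.1 hw'.2]

theorem abs_le_height {v w : V} (hne : w ≠ v) (hadj : ¬ Γ.Adj v w) (x : V → ℤ) :
    |x w| ≤ height Γ v x :=
  Finset.single_le_sum (f := fun w => |x w|) (fun _ _ => abs_nonneg _) (by simp [hne, hadj])

theorem height_nonneg (v : V) (x : V → ℤ) : 0 ≤ height Γ v x :=
  Finset.sum_nonneg fun _ _ => abs_nonneg _

open Classical in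
theorem height_update_self (v : V) (x : V → ℤ) (c : ℤ) :
    height Γ v (Function.update x v c) = height Γ v x :=
  height_congr Γ fun _ hw _ => Function.update_of_ne hw _ _

open Classical in
theorem height_update_adj {v w : V} (h : Γ.Adj v w) (x : V → ℤ) (c : ℤ) :
    height Γ v (Function.update x w c) = height Γ v x :=
  height_congr Γ fun u _ hu => Function.update_of_ne (by rintro rfl; exact hu h) _ _

open Classical in
/-- The permutation of `ℤ^V` by which the vertex `v` acts. -/
noncomputable def shift (v : V) : Equiv.Perm (V → ℤ) where
  -- With H the height, 2H + 1 is the least step that carries every coordinate ≥ -H beyond H.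
  toFun x := Function.update x v (x v + (2 * height Γ v x + 1))
  invFun x := Function.update x v (x v - (2 * height Γ v x + 1))
  left_inv x := by simp [height_update_self]
  right_inv x := by simp [height_update_self]

theorem shift_comm {v w : V} (h : Γ.Adj v w) : Commute (shift Γ v) (shift Γ w) := by
  classical
  ext1 x
  simp only [Equiv.Perm.mul_apply, shift, Equiv.coe_fn_mk]
  rw [height_update_adj Γ h, height_update_adj Γ h.symm, Function.update_of_ne h.ne,
    Function.update_of_ne h.ne', Function.update_comm h.ne']

/-- The action of `A_Γ` on `ℤ^V`. -/
noncomputable def act : Artin Γ →* Equiv.Perm (V → ℤ) :=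
  PresentedGroup.toGroup (f := shift Γ) (by
    rintro _ ⟨v, w, hvw, rfl⟩
    rw [map_commutatorElement, FreeGroup.lift_apply_of, FreeGroup.lift_apply_of,
      commutatorElement_eq_one_iff_commute]
    exact shift_comm Γ hvw)

open Classical in
theorem act_edgeElt (a : V × Bool) (x : V → ℤ) :
    act Γ (edgeElt Γ a) x = Function.update x a.1
      (x a.1 + if a.2 then 2 * height Γ a.1 x + 1 else -(2 * height Γ a.1 x + 1)) := by
  have key : ∀ v : V, act Γ (edgeElt Γ (v, true)) = shift Γ v :=
    fun v => PresentedGroup.toGroup.of _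
  obtain ⟨v, b⟩ := a
  cases b
  · have : edgeElt Γ (v, false) = (edgeElt Γ (v, true))⁻¹ := edgeElt_rev Γ (v, true)
    rw [this, map_inv, key]
    change Function.update x v _ = _
    simp [sub_eq_add_neg]
  · rw [key]
    change Function.update x v _ = _
    simp

/-- The ping-pong set of an oriented edge. -/
def side (a : V × Bool) (x : V → ℤ) : Prop :=
  height Γ a.1 x < if a.2 then x a.1 else -x a.1

theorem side_act_self (a : V × Bool) (x : V → ℤ) :
    side Γ a (act Γ (edgeElt Γ a) x) ↔ ¬ side Γ (rev a) x := by
  classical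
  rw [act_edgeElt, side, side, height_update_self, Function.update_self]
  obtain ⟨v, b⟩ := a
  cases b <;> simp only [rev, Bool.not_true, Bool.not_false, if_true, Bool.false_eq_true, if_false]
    <;> omega

theorem side_act_adj {a b : V × Bool} (h : Γ.Adj a.1 b.1) (x : V → ℤ) :
    side Γ a (act Γ (edgeElt Γ b) x) ↔ side Γ a x := by
  classical
  rw [act_edgeElt, side, side, height_update_adj Γ h, Function.update_of_ne h.ne]

/-- For distinct non-adjacent vertices each coordinate is counted in the height at the other, so
each absolute value would be strictly smaller than the other. -/
theorem side_disjoint {a b : V × Bool} (hne : a ≠ b) (h : ¬ Γ.Adj a.1 b.1) {x : V → ℤ}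
    (ha : side Γ a x) (hb : side Γ b x) : False := by
  obtain ⟨v, s⟩ := a
  obtain ⟨w, t⟩ := b
  by_cases hvw : w = v
  · subst hvw
    have := height_nonneg Γ w x
    cases s <;> cases t <;> simp [side] at ha hb hne <;> omega
  · have h1 := abs_le_height Γ hvw h x
    have h2 := abs_le_height Γ (Ne.symm hvw) (fun h' => h h'.symm) x
    have ha' : height Γ v x < |x v| := by
      refine lt_of_lt_of_le ha ?_
      dsimp only
      split_ifs
      · exact le_abs_self _
      · exact neg_le_abs _
    have hb' : height Γ w x < |x w| := by
      refine lt_of_lt_of_le hb ?_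
      dsimp only
      split_ifs
      · exact le_abs_self _
      · exact neg_le_abs _
    omega

end Action

/-! ### First letters -/

section Leads

variable {V : Type*} [Finite V] {Γ : SimpleGraph V}

/-- `Leads a g` holds iff some reduced word for `g` begins with the letter `a`. -/
def Leads (a : V × Bool) (g : Artin Γ) : Prop := side Γ a (act Γ g 0)

theorem not_leads_one (a : V × Bool) : ¬ Leads a (1 : Artin Γ) := by
  rw [Leads, map_one, side]
  have := height_nonneg Γ a.1 0
  simpa using this

theorem leads_mul_self {a : V × Bool} {g : Artin Γ} :
    Leads a (edgeElt Γ a * g) ↔ ¬ Leads (rev a) g := by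
  rw [Leads, map_mul]
  exact side_act_self Γ a _

theorem leads_mul_adj {a b : V × Bool} (h : Γ.Adj a.1 b.1) {g : Artin Γ} :
    Leads a (edgeElt Γ b * g) ↔ Leads a g := by
  rw [Leads, map_mul]
  exact side_act_adj Γ h _

theorem Leads.not_leads {a b : V × Bool} {g : Artin Γ} (ha : Leads a g) (hne : a ≠ b)
    (h : ¬ Γ.Adj a.1 b.1) : ¬ Leads b g :=
  fun hb => side_disjoint Γ hne h ha hb

theorem Leads.not_leads_rev {a : V × Bool} {g : Artin Γ} (ha : Leads a g) : ¬ Leads (rev a) g :=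
  ha.not_leads (ne_rev a) (SimpleGraph.irrefl Γ)

theorem leads_inv_mul_self {a : V × Bool} {g : Artin Γ} :
    Leads (rev a) ((edgeElt Γ a)⁻¹ * g) ↔ ¬ Leads a g := by
  rw [← edgeElt_rev, leads_mul_self, rev_rev]

theorem leads_inv_mul_adj {a b : V × Bool} (h : Γ.Adj a.1 b.1) {g : Artin Γ} :
    Leads a ((edgeElt Γ b)⁻¹ * g) ↔ Leads a g := by
  rw [← edgeElt_rev, leads_mul_adj (b := rev b) h]

theorem leads_edgeElt {a b : V × Bool} : Leads a (edgeElt Γ b) ↔ a = b := by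
  have hb : Leads b (edgeElt Γ b) := by
    simpa using (leads_mul_self (a := b) (g := (1 : Artin Γ))).2 (not_leads_one _)
  refine ⟨fun ha => ?_, fun h => h ▸ hb⟩
  by_contra hne
  by_cases h : Γ.Adj a.1 b.1
  · have := (leads_mul_adj h (g := 1)).1 (by simpa using ha)
    exact not_leads_one _ this
  · exact ha.not_leads hne h hb

/-! ### First letters and length -/

/-- A letter adjacent to a can be passed over. If the word starts with any other letter b ≠ a,
ping-pong forces the rest to lead with the inverse of b; cancelling the two leaves a shorter word,
to which induction applies again. -/
theorem exists_shorter_word {a : V × Bool} : ∀ {l : List (V × Bool)}, Leads a (wordElt Γ l) →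
    ∃ m, wordElt Γ m = (edgeElt Γ a)⁻¹ * wordElt Γ l ∧ m.length < l.length := by
  intro l
  induction hn : l.length using Nat.strong_induction_on generalizing l a with
  | _ n ih =>
    intro h
    subst hn
    cases l with
    | nil => exact absurd h (not_leads_one a)
    | cons b l =>
      by_cases hab : a = b
      · subst hab
        exact ⟨l, by simp, by simp⟩
      rw [wordElt_cons] at h ⊢
      by_cases hadj : Γ.Adj a.1 b.1
      · obtain ⟨m, hm, hlt⟩ := ih _ (by simp) rfl ((leads_mul_adj hadj).1 h)
        refine ⟨b :: m, ?_, by simpa using hlt⟩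
        rw [wordElt_cons, hm, ← mul_assoc, ← mul_assoc,
          (edgeElt_commute Γ hadj).inv_left.eq]
      · have hb : Leads (rev b) (wordElt Γ l) := by
          by_contra hb
          exact h.not_leads hab hadj (leads_mul_self.2 hb)
        obtain ⟨m, hm, hlt⟩ := ih _ (by simp) rfl hb
        rw [edgeElt_rev, inv_inv] at hm
        rw [← hm] at h ⊢
        obtain ⟨m', hm', hlt'⟩ := ih m.length (by simp; omega) rfl h
        exact ⟨m', hm', by simp; omega⟩

theorem Leads.len_inv_mul {a : V × Bool} {g : Artin Γ} (h : Leads a g) :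
    len ((edgeElt Γ a)⁻¹ * g) + 1 = len g := by
  obtain ⟨l, rfl, hl⟩ := exists_geodesic g
  obtain ⟨m, hm, hlt⟩ := exists_shorter_word h
  have h1 := len_wordElt_le (Γ := Γ) m
  have h2 := len_mul_le (edgeElt Γ a) ((edgeElt Γ a)⁻¹ * wordElt Γ l)
  rw [mul_inv_cancel_left] at h2
  have h3 := len_edgeElt_le (Γ := Γ) a
  rw [hm] at h1
  omega

theorem len_mul_of_not_leads {a : V × Bool} {g : Artin Γ} (h : ¬ Leads (rev a) g) :
    len (edgeElt Γ a * g) = len g + 1 := by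
  have := (leads_mul_self.2 h).len_inv_mul
  rw [inv_mul_cancel_left] at this
  exact this.symm

theorem leads_iff_len_lt {a : V × Bool} {g : Artin Γ} :
    Leads a g ↔ len ((edgeElt Γ a)⁻¹ * g) < len g := by
  refine ⟨fun h => by have := h.len_inv_mul; omega, fun h => ?_⟩
  by_contra h'
  have := len_mul_of_not_leads (a := rev a) (g := g) (by rwa [rev_rev])
  rw [edgeElt_rev] at this
  omega

theorem exists_leads {g : Artin Γ} (h : g ≠ 1) : ∃ a, Leads a g := by
  obtain ⟨l, rfl, hl⟩ := exists_geodesic g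
  cases l with
  | nil => exact absurd rfl h
  | cons a l =>
    refine ⟨a, leads_iff_len_lt.2 ?_⟩
    rw [← hl, wordElt_cons, inv_mul_cancel_left, List.length_cons]
    exact Nat.lt_succ_of_le (len_wordElt_le l)

theorem Leads.mul_of_len {a : V × Bool} {g h : Artin Γ} (ha : Leads a g)
    (hl : len (g * h) = len g + len h) : Leads a (g * h) := by
  rw [leads_iff_len_lt, hl, ← mul_assoc]
  have := len_mul_le ((edgeElt Γ a)⁻¹ * g) h
  have := ha.len_inv_mul
  omega

theorem len_inv_mul_cases (a : V × Bool) (g : Artin Γ) :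
    len ((edgeElt Γ a)⁻¹ * g) + 1 = len g ∨ len ((edgeElt Γ a)⁻¹ * g) = len g + 1 := by
  by_cases h : Leads a g
  · exact Or.inl h.len_inv_mul
  · right
    rw [← edgeElt_rev]
    exact len_mul_of_not_leads (by rwa [rev_rev])

theorem len_mul_cases (a : V × Bool) (g : Artin Γ) :
    len (g * edgeElt Γ a) + 1 = len g ∨ len (g * edgeElt Γ a) = len g + 1 := by
  have := len_inv_mul_cases a g⁻¹
  rwa [← mul_inv_rev, len_inv, len_inv] at this

end Leads

/-! ### Walls -/

section Walls

variable {V : Type*} [Finite V] {Γ : SimpleGraph V}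

theorem eq_of_wall_or {a b : V × Bool} {g : Artin Γ} (hg : ¬ Leads a g)
    (hgb : Leads a (g * edgeElt Γ b))
    (h : g * edgeElt Γ b = edgeElt Γ a * g ∨ edgeElt Γ a * g * edgeElt Γ b = g) :
    g * edgeElt Γ b = edgeElt Γ a * g := by
  refine h.resolve_right fun h => hg ?_
  rw [← h, mul_assoc, leads_mul_self]
  exact hgb.not_leads_rev

/-- This is the exchange condition: an edge on which the truth of `Leads a` changes has endpoints
swapped by left multiplication by a, in one direction or the other. -/
theorem wall_or : ∀ (n : ℕ) {g : Artin Γ}, len g < n → ∀ {a b : V × Bool},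
    ¬ (Leads a g ↔ Leads a (g * edgeElt Γ b)) →
    g * edgeElt Γ b = edgeElt Γ a * g ∨ edgeElt Γ a * g * edgeElt Γ b = g := by
  intro n
  induction n with
  | zero => exact fun hn => absurd hn (Nat.not_lt_zero _)
  | succ n ih =>
    intro g hn a b hab
    -- If g b is shorter than g, the edge is read backwards, so that g may be taken as the shorter
    -- endpoint.
    rcases len_mul_cases b g with hlen | hlen
    · have := ih (g := g * edgeElt Γ b) (by omega) (a := a) (b := rev b) (by
        rwa [edgeElt_rev, mul_inv_cancel_right, Iff.comm])
      rw [edgeElt_rev, mul_inv_cancel_right, ← mul_assoc, mul_inv_cancel_right] at this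
      exact this.symm.imp Eq.symm Eq.symm
    by_cases hg : g = 1
    · subst hg
      have hb : Leads a (edgeElt Γ b) := by
        by_contra h
        refine hab (iff_of_false (not_leads_one a) ?_)
        rwa [one_mul]
      rw [leads_edgeElt] at hb
      subst hb
      simp
    obtain ⟨c, hc⟩ := exists_leads hg
    obtain ⟨k, rfl⟩ : ∃ k, g = edgeElt Γ c * k := ⟨(edgeElt Γ c)⁻¹ * g, by simp⟩
    have hk : len k < n := by
      have := hc.len_inv_mul
      rw [inv_mul_cancel_left] at this
      omega
    rw [mul_assoc] at hab
    by_cases hca : a = c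
    · subst hca
      rw [leads_mul_self, leads_mul_self, not_iff_not] at hab
      rcases ih hk hab with h | h
      · right
        rw [mul_assoc, mul_assoc, h, edgeElt_rev, mul_inv_cancel_left]
      · left
        rw [edgeElt_rev, mul_assoc, inv_mul_eq_iff_eq_mul] at h
        rw [mul_assoc, h]
    by_cases hadj : Γ.Adj a.1 c.1
    · rw [leads_mul_adj hadj, leads_mul_adj hadj] at hab
      have hcomm := (edgeElt_commute Γ hadj).eq
      rcases ih hk hab with h | h
      · left
        rw [mul_assoc, h, ← mul_assoc, ← mul_assoc, hcomm]
      · right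
        rw [← mul_assoc, hcomm, mul_assoc, mul_assoc, ← mul_assoc (edgeElt Γ a), h]
    -- Here a and c cannot both lead, so the edge from k to k b crosses the wall of the inverse of
    -- c. Then g b = k, which contradicts g b being longer than g.
    · exfalso
      have h1 : ¬ Leads a (edgeElt Γ c * k) := fun h => h.not_leads hca hadj hc
      have h2 : Leads a (edgeElt Γ c * (k * edgeElt Γ b)) := by
        by_contra h
        exact hab (iff_of_false h1 h)
      have h3 : Leads (rev c) (k * edgeElt Γ b) := by
        by_contra h
        exact h2.not_leads hca hadj (leads_mul_self.2 h)
      have h4 : ¬ Leads (rev c) k := leads_mul_self.1 hc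
      have h5 := eq_of_wall_or h4 h3 (ih hk fun h => h4 (h.2 h3))
      rw [mul_assoc, h5, edgeElt_rev, mul_inv_cancel_left] at hlen
      have := hc.len_inv_mul
      rw [inv_mul_cancel_left] at this
      omega

theorem mul_edgeElt_of_leads {a b : V × Bool} {g : Artin Γ} (hg : ¬ Leads a g)
    (hgb : Leads a (g * edgeElt Γ b)) : g * edgeElt Γ b = edgeElt Γ a * g :=
  eq_of_wall_or hg hgb (wall_or _ (Nat.lt_succ_self _) fun h => hg (h.2 hgb))

theorem eq_mul_mul_edgeElt {a b : V × Bool} {g : Artin Γ} (hg : Leads a g)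
    (hgb : ¬ Leads a (g * edgeElt Γ b)) : g = edgeElt Γ a * (g * edgeElt Γ b) := by
  have := mul_edgeElt_of_leads (b := rev b) hgb (by rwa [edgeElt_rev, mul_inv_cancel_right])
  rwa [edgeElt_rev, mul_inv_cancel_right] at this

theorem edgeElt_injective : Function.Injective (edgeElt Γ) :=
  fun a b h => leads_edgeElt.1 (by rw [← h, leads_edgeElt])

/-- If the edge from `g` to `g b` crosses the wall of the letter `a`, then `b = a` and `g`
stabilizes that wall. -/
theorem wall_stable : ∀ (n : ℕ) {g : Artin Γ}, len g < n → ∀ {a b : V × Bool}, ¬ Leads a g →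
    Leads a (g * edgeElt Γ b) → b = a ∧ ∀ q, Leads a (g * q) ↔ Leads a q := by
  intro n
  induction n with
  | zero => exact fun hn => absurd hn (Nat.not_lt_zero _)
  | succ n ih =>
    intro g hn a b hga hgb
    by_cases hg : g = 1
    · subst hg
      rw [one_mul, leads_edgeElt] at hgb
      exact ⟨hgb.symm, fun q => by rw [one_mul]⟩
    have heq := mul_edgeElt_of_leads hga hgb
    have hga' : ¬ Leads (rev a) g := by rwa [heq, leads_mul_self] at hgb
    obtain ⟨c, hc⟩ := exists_leads hg
    obtain ⟨k, rfl⟩ : ∃ k, g = edgeElt Γ c * k := ⟨(edgeElt Γ c)⁻¹ * g, by simp⟩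
    have hk : len k < n := by
      have := hc.len_inv_mul
      rw [inv_mul_cancel_left] at this
      omega
    have hca : a ≠ c := by
      rintro rfl
      exact hga hc
    by_cases hadj : Γ.Adj a.1 c.1
    · rw [mul_assoc] at hgb
      rw [leads_mul_adj hadj] at hga hgb
      refine (ih hk hga hgb).imp_right fun h q => ?_
      rw [mul_assoc, leads_mul_adj hadj, h]
    -- The edge also leaves the half-space of c, so g = c a g and c is the inverse of a. But the
    -- inverse of a does not lead g, because a leads a g.
    · exfalso
      have h := eq_mul_mul_edgeElt hc (hgb.not_leads hca hadj)
      rw [heq] at h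
      have h' : edgeElt Γ (rev c) = edgeElt Γ a := by
        rw [edgeElt_rev, inv_eq_iff_mul_eq_one, ← mul_left_inj (edgeElt Γ c * k), one_mul,
          mul_assoc, ← h]
      refine hga' ?_
      rw [← edgeElt_injective h', rev_rev]
      exact hc

/-- The half-space that contains `p b` but not `p`, and whose wall separates the two. -/
def halfSpace (p : Artin Γ) (b : V × Bool) : Set (Artin Γ) := {q | Leads b (p⁻¹ * q)}

theorem mem_halfSpace {p q : Artin Γ} {b : V × Bool} :
    q ∈ halfSpace p b ↔ Leads b (p⁻¹ * q) := Iff.rfl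

theorem mul_mem_halfSpace_mul {g p q : Artin Γ} {b : V × Bool} :
    g * q ∈ halfSpace (g * p) b ↔ q ∈ halfSpace p b := by
  rw [mem_halfSpace, mem_halfSpace, mul_inv_rev, mul_assoc, inv_mul_cancel_left]

theorem mem_halfSpace_mul {g p q : Artin Γ} {b : V × Bool} :
    q ∈ halfSpace (g * p) b ↔ g⁻¹ * q ∈ halfSpace p b := by
  rw [← mul_mem_halfSpace_mul (g := g) (q := g⁻¹ * q), mul_inv_cancel_left]

theorem self_notMem_halfSpace (p : Artin Γ) (b : V × Bool) : p ∉ halfSpace p b := by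
  rw [mem_halfSpace, inv_mul_cancel]
  exact not_leads_one b

theorem mul_edgeElt_mem_halfSpace {p : Artin Γ} {b c : V × Bool} :
    p * edgeElt Γ c ∈ halfSpace p b ↔ b = c := by
  rw [mem_halfSpace, inv_mul_cancel_left, leads_edgeElt]

theorem mem_halfSpace_rev {p q : Artin Γ} {b : V × Bool} :
    q ∈ halfSpace (p * edgeElt Γ b) (rev b) ↔ q ∉ halfSpace p b := by
  rw [mem_halfSpace, mem_halfSpace, mul_inv_rev, mul_assoc, leads_inv_mul_self]

/-- A half-space is determined by any edge that enters it, and the label of that edge is its own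
letter. -/
theorem halfSpace_of_crossing {p r : Artin Γ} {b c : V × Bool} (hp : p ∉ halfSpace r b)
    (hpc : p * edgeElt Γ c ∈ halfSpace r b) : c = b ∧ halfSpace r b = halfSpace p b := by
  rw [mem_halfSpace, ← mul_assoc] at hpc
  obtain ⟨h, h'⟩ := wall_stable _ (Nat.lt_succ_self _) hp hpc
  refine ⟨h, Set.ext fun q => ?_⟩
  rw [mem_halfSpace, mem_halfSpace, ← h' (p⁻¹ * q), mul_assoc, mul_inv_cancel_left]

theorem halfSpace_label {p r : Artin Γ} {b c : V × Bool} (h : halfSpace p b = halfSpace r c) :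
    b = c := by
  refine (halfSpace_of_crossing (p := p) (r := r) (b := c) (c := b) ?_ ?_).1
  · rw [← h]
    exact self_notMem_halfSpace p b
  · rw [← h, mul_edgeElt_mem_halfSpace]

/-- A path that enters a half-space has an edge that crosses its wall. -/
theorem exists_crossing {r : Artin Γ} {b : V × Bool} (l : List (V × Bool)) {p : Artin Γ}
    (hp : p ∉ halfSpace r b) (hq : p * wordElt Γ l ∈ halfSpace r b) : b ∈ l := by
  induction l generalizing p with
  | nil => rw [wordElt_nil, mul_one] at hq; exact absurd hq hp
  | cons c l ih =>
    by_cases h : p * edgeElt Γ c ∈ halfSpace r b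
    · rw [(halfSpace_of_crossing hp h).1]
      exact List.mem_cons_self
    · rw [wordElt_cons, ← mul_assoc] at hq
      exact List.mem_cons_of_mem _ (ih h hq)

/-- The half-spaces that contain `q` but not `p`. -/
def separators (p q : Artin Γ) : Set (Set (Artin Γ)) :=
  {k | (∃ r b, k = halfSpace r b) ∧ p ∉ k ∧ q ∈ k}

theorem separators_mul_edgeElt_mul_subset (p g : Artin Γ) (a : V × Bool) :
    separators p (p * (edgeElt Γ a * g)) ⊆
      insert (halfSpace p a) (separators (p * edgeElt Γ a) (p * edgeElt Γ a * g)) := by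
  rintro _ ⟨⟨r, b, rfl⟩, hp, hq⟩
  by_cases h : p * edgeElt Γ a ∈ halfSpace r b
  · obtain ⟨rfl, h'⟩ := halfSpace_of_crossing hp h
    exact Or.inl h'
  · exact Or.inr ⟨⟨r, b, rfl⟩, h, by rwa [mul_assoc]⟩

theorem separators_wordElt (l : List (V × Bool)) (p : Artin Γ) :
    (separators p (p * wordElt Γ l)).Finite ∧
      (separators p (p * wordElt Γ l)).ncard ≤ l.length := by
  induction l generalizing p with
  | nil =>
    have : separators p (p * wordElt Γ []) = ∅ := by
      rw [Set.eq_empty_iff_forall_notMem]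
      rintro k ⟨-, h1, h2⟩
      rw [wordElt_nil, mul_one] at h2
      exact h1 h2
    rw [this]
    simp
  | cons a l ih =>
    obtain ⟨hfin, hcard⟩ := ih (p * edgeElt Γ a)
    have hsub := separators_mul_edgeElt_mul_subset p (wordElt Γ l) a
    rw [wordElt_cons]
    refine ⟨(hfin.insert _).subset hsub, ?_⟩
    refine (Set.ncard_le_ncard hsub (hfin.insert _)).trans ((Set.ncard_insert_le _ _).trans ?_)
    simpa using hcard

theorem separators_finite (p q : Artin Γ) : (separators p q).Finite := by
  obtain ⟨l, hl⟩ := exists_wordElt (p⁻¹ * q)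
  have := (separators_wordElt l p).1
  rwa [hl, mul_inv_cancel_left] at this

theorem ncard_separators_le (p q : Artin Γ) : (separators p q).ncard ≤ len (p⁻¹ * q) := by
  obtain ⟨l, hl, hlen⟩ := exists_geodesic (p⁻¹ * q)
  have := (separators_wordElt l p).2
  rwa [hl, mul_inv_cancel_left, hlen] at this

/-- The first letter of a geodesic contributes a new half-space and destroys none: one that contains
p but not p a would be the complement of the half-space just entered, and the endpoint is not in it.
-/
theorem len_le_ncard_separators : ∀ (n : ℕ) (p : Artin Γ) {u : Artin Γ}, len u = n →
    n ≤ (separators p (p * u)).ncard := by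
  intro n
  induction n with
  | zero => exact fun _ _ _ => Nat.zero_le _
  | succ n ih =>
    intro p u hu
    obtain ⟨a, ha⟩ := exists_leads (g := u) (by rintro rfl; simp at hu)
    obtain ⟨k, rfl⟩ : ∃ k, u = edgeElt Γ a * k := ⟨(edgeElt Γ a)⁻¹ * u, by simp⟩
    have hk := ha.len_inv_mul
    rw [inv_mul_cancel_left] at hk
    have hsub : insert (halfSpace p a) (separators (p * edgeElt Γ a) (p * edgeElt Γ a * k)) ⊆
        separators p (p * (edgeElt Γ a * k)) := by
      rintro _ (rfl | ⟨⟨r, b, rfl⟩, h1, h2⟩)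
      · refine ⟨⟨_, _, rfl⟩, self_notMem_halfSpace p a, ?_⟩
        rwa [mem_halfSpace, inv_mul_cancel_left]
      · rw [mul_assoc] at h2
        refine ⟨⟨r, b, rfl⟩, fun hp => ?_, h2⟩
        obtain ⟨rfl, h3⟩ := halfSpace_of_crossing (c := rev a) h1 (by
          rwa [edgeElt_rev, mul_inv_cancel_right])
        rw [h3, mem_halfSpace_rev, mem_halfSpace, inv_mul_cancel_left] at h2
        exact h2 ha
    refine le_trans ?_ (Set.ncard_le_ncard hsub (separators_finite _ _))
    rw [Set.ncard_insert_of_notMem _ (separators_finite _ _)]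
    · exact Nat.succ_le_succ (ih _ (by omega))
    · rintro ⟨-, h, -⟩
      exact h (mul_edgeElt_mem_halfSpace.2 rfl)

end Walls

/-! ### Conjugation by letters -/

section Conj

/-- `Shortens g k`: the element `g` maps the complement of `k` into `k`. -/
def Shortens {G : Type*} [Group G] (g : G) (k : Set G) : Prop := ∀ q, q ∉ k → g * q ∈ k

theorem Shortens.mono {G : Type*} [Group G] {g : G} {k m : Set G} (h : Shortens g k) (hkm : k ⊆ m) :
    Shortens g m :=
  fun q hq => hkm (h q fun hqk => hq (hkm hqk))

variable {V : Type*} [Finite V] {Γ : SimpleGraph V}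

/-- Without a common first letter nothing cancels in p⁻¹ q. A first letter of the product comes from
p⁻¹, or it is adjacent to everything in p and has come through from q. -/
theorem len_inv_mul_of_forall : ∀ (n : ℕ) {p q : Artin Γ}, len p = n →
    (∀ d, Leads d p → ¬ Leads d q) →
    len (p⁻¹ * q) = n + len q ∧
      ∀ c, Leads c (p⁻¹ * q) → Leads c p⁻¹ ∨ ∀ r, Leads c (p⁻¹ * r) ↔ Leads c r := by
  intro n
  induction n with
  | zero =>
    intro p q hp _
    rw [eq_one_of_len_eq_zero hp, inv_one]
    simp
  | succ n ih =>
    intro p q hp h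
    obtain ⟨d, hd⟩ := exists_leads (g := p) (by rintro rfl; simp at hp)
    obtain ⟨k, rfl⟩ : ∃ k, p = edgeElt Γ d * k := ⟨(edgeElt Γ d)⁻¹ * p, by simp⟩
    have hk := hd.len_inv_mul
    rw [inv_mul_cancel_left] at hk
    have hdq : Leads (rev d) ((edgeElt Γ d)⁻¹ * q) := leads_inv_mul_self.2 (h d hd)
    have hlen : len ((edgeElt Γ d)⁻¹ * q) = len q + 1 := by
      rw [← edgeElt_rev]
      exact len_mul_of_not_leads (by rw [rev_rev]; exact h d hd)
    obtain ⟨h1, h2⟩ := ih (p := k) (q := (edgeElt Γ d)⁻¹ * q) (by omega) (by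
      intro e he heq
      by_cases hed : e = rev d
      · subst hed
        exact leads_mul_self.1 hd he
      by_cases hadj : Γ.Adj e.1 d.1
      · rw [leads_inv_mul_adj hadj] at heq
        exact h e ((leads_mul_adj hadj).2 he) heq
      · exact heq.not_leads hed hadj hdq)
    simp only [mul_inv_rev, mul_assoc]
    refine ⟨by omega, fun c hc => ?_⟩
    rcases h2 c hc with h3 | h3
    · left
      refine h3.mul_of_len ?_
      rw [← mul_inv_rev, len_inv, len_inv, ← edgeElt_rev]
      have hle := len_edgeElt_le (Γ := Γ) (rev d)
      have htri := len_mul_le k⁻¹ (edgeElt Γ (rev d))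
      rw [edgeElt_rev, ← mul_inv_rev, len_inv, len_inv, ← edgeElt_rev] at htri
      omega
    · have hcq := (h3 _).1 hc
      by_cases hcd : c = rev d
      · left
        subst hcd
        rw [h3, ← edgeElt_rev, leads_edgeElt]
      · right
        intro r
        have hadj : Γ.Adj c.1 d.1 := by
          by_contra hadj
          exact hcq.not_leads hcd hadj hdq
        rw [h3, leads_inv_mul_adj hadj]

theorem not_leads_of_len_conj {a : V × Bool} {h : Artin Γ}
    (hl : len ((edgeElt Γ a)⁻¹ * h * edgeElt Γ a) = len h + 2) :
    ¬ Leads a h ∧ ¬ Leads a h⁻¹ := by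
  constructor
  · intro ha
    have := ha.len_inv_mul
    have := len_mul_cases a ((edgeElt Γ a)⁻¹ * h)
    omega
  · intro ha
    have h1 := ha.len_inv_mul
    rw [← mul_inv_rev, len_inv, len_inv] at h1
    have := len_inv_mul_cases a (h * edgeElt Γ a)
    rw [← mul_assoc] at this
    omega

/-- First letters of h adjacent to a are stripped off. When none is left, h and q share no first
letter, so nothing cancels in h⁻¹ q. If a led this product, it would lead h⁻¹ or commute with h, and
both contradict the gain of 2. -/
theorem not_leads_mul_of_len_conj : ∀ (n : ℕ) {a : V × Bool} {h : Artin Γ}, len h = n →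
    len ((edgeElt Γ a)⁻¹ * h * edgeElt Γ a) = n + 2 → ∀ {q}, Leads a q → ¬ Leads a (h⁻¹ * q) := by
  intro n
  induction n with
  | zero =>
    intro a h hn hl
    rw [eq_one_of_len_eq_zero hn] at hl
    simp at hl
  | succ n ih =>
    intro a h hn hl q hq hq'
    obtain ⟨h1, h2⟩ := not_leads_of_len_conj (by rw [hl, hn])
    by_cases hd : ∃ d, Leads d h ∧ Γ.Adj a.1 d.1
    · obtain ⟨d, hd, hadj⟩ := hd
      obtain ⟨k, rfl⟩ : ∃ k, h = edgeElt Γ d * k := ⟨(edgeElt Γ d)⁻¹ * h, by simp⟩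
      have hk := hd.len_inv_mul
      rw [inv_mul_cancel_left] at hk
      have hcomm := (edgeElt_commute Γ hadj).inv_left.eq
      refine ih (a := a) (h := k) (q := (edgeElt Γ d)⁻¹ * q) (by omega) ?_ ?_ ?_
      · rw [← mul_assoc, hcomm, mul_assoc, mul_assoc] at hl
        have b1 := len_mul_le (edgeElt Γ d) ((edgeElt Γ a)⁻¹ * (k * edgeElt Γ a))
        have b2 := len_edgeElt_le (Γ := Γ) d
        rw [← mul_assoc (edgeElt Γ a)⁻¹] at hl b1
        have b3 := len_inv_mul_cases a k
        have b4 := len_mul_cases a ((edgeElt Γ a)⁻¹ * k)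
        omega
      · rwa [leads_inv_mul_adj hadj]
      · rwa [mul_inv_rev, mul_assoc] at hq'
    · obtain ⟨-, h3⟩ := len_inv_mul_of_forall (n + 1) (p := h) (q := q) hn (by
        intro d hdh hdq
        by_cases hda : a = d
        · subst hda
          exact h1 hdh
        · exact hq.not_leads hda (fun hadj => hd ⟨d, hdh, hadj⟩) hdq)
      rcases h3 a hq' with h4 | h4
      · exact h2 h4
      · have h5 := mul_edgeElt_of_leads (b := a) h2 ((h4 _).2 (leads_edgeElt.2 rfl))
        have h6 : Commute h (edgeElt Γ a) := by
          simpa using Commute.inv_left (a := h⁻¹) h5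
        rw [mul_assoc, h6.eq, inv_mul_cancel_left] at hl
        omega

/-- Conjugation by `a` lengthens `h`: then `h` moves the half-space of `a` off itself. -/
theorem not_leads_mul_of_gain {a : V × Bool} {h q : Artin Γ}
    (hl : len ((edgeElt Γ a)⁻¹ * h * edgeElt Γ a) = len h + 2) (hq : Leads a q) :
    ¬ Leads a (h * q) := by
  have := not_leads_mul_of_len_conj (len h) (a := a) (h := h⁻¹) (len_inv h) (by
    rw [← hl, ← len_inv]
    congr 1
    group) hq
  rwa [inv_inv] at this

/-- The letter a leads both g and its inverse; the point is that the two cancellations are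
independent. -/
theorem len_conj_of_shortens {a : V × Bool} {g : Artin Γ} (h : Shortens g (halfSpace 1 a)) :
    len ((edgeElt Γ a)⁻¹ * g * edgeElt Γ a) + 2 = len g := by
  simp only [Shortens, mem_halfSpace, inv_one, one_mul] at h
  have h1 : Leads a g := by simpa using h 1 (not_leads_one a)
  have h2 : Leads a g⁻¹ := by
    by_contra h2
    have := h _ h2
    rw [mul_inv_cancel] at this
    exact not_leads_one a this
  -- Otherwise the edge from g⁻¹ a back to g⁻¹ would enter the half-space of a along the opposite
  -- letter.
  have h3 : Leads a (g⁻¹ * edgeElt Γ a) := by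
    by_contra h3
    refine ne_rev a (wall_stable _ (Nat.lt_succ_self _) (b := rev a) h3 ?_).1.symm
    rwa [edgeElt_rev, mul_inv_cancel_right]
  have h4 := h2.len_inv_mul
  have h5 := h3.len_inv_mul
  have h6 := h1.len_inv_mul
  have e1 : len ((edgeElt Γ a)⁻¹ * (g⁻¹ * edgeElt Γ a)) =
      len ((edgeElt Γ a)⁻¹ * g * edgeElt Γ a) := by
    rw [← len_inv]
    congr 1
    group
  have e2 : len (g⁻¹ * edgeElt Γ a) = len ((edgeElt Γ a)⁻¹ * g) := by
    rw [← len_inv]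
    congr 1
    group
  omega

/-- Undoing the conjugation lengthens by 2, so the gain criterion applies to the shortened conjugate
and the reversed letter. -/
theorem shortens_of_len_conj {a : V × Bool} {g : Artin Γ}
    (h : len ((edgeElt Γ a)⁻¹ * g * edgeElt Γ a) + 2 = len g) : Shortens g (halfSpace 1 a) := by
  intro q hq
  rw [mem_halfSpace, inv_one, one_mul] at hq ⊢
  have e1 : (edgeElt Γ (rev a))⁻¹ * ((edgeElt Γ a)⁻¹ * g * edgeElt Γ a) * edgeElt Γ (rev a) = g := by
    rw [edgeElt_rev]
    group
  have h1 := not_leads_mul_of_gain (a := rev a) (h := (edgeElt Γ a)⁻¹ * g * edgeElt Γ a)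
    (q := (edgeElt Γ a)⁻¹ * q) (by rw [e1, h]) (leads_inv_mul_self.2 hq)
  have e2 : (edgeElt Γ a)⁻¹ * g * edgeElt Γ a * ((edgeElt Γ a)⁻¹ * q) =
      (edgeElt Γ a)⁻¹ * (g * q) := by group
  rw [e2, leads_inv_mul_self, not_not] at h1
  exact h1

theorem len_conj_cases (a : V × Bool) (g : Artin Γ) :
    len ((edgeElt Γ a)⁻¹ * g * edgeElt Γ a) + 2 = len g ∨
      len ((edgeElt Γ a)⁻¹ * g * edgeElt Γ a) = len g ∨
      len ((edgeElt Γ a)⁻¹ * g * edgeElt Γ a) = len g + 2 := by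
  have := len_inv_mul_cases a g
  have := len_mul_cases a ((edgeElt Γ a)⁻¹ * g)
  omega

theorem shortens_halfSpace_iff {a : V × Bool} {g p : Artin Γ} :
    Shortens g (halfSpace p a) ↔
      len ((p * edgeElt Γ a)⁻¹ * g * (p * edgeElt Γ a)) + 2 = len (p⁻¹ * g * p) := by
  have e1 : (p * edgeElt Γ a)⁻¹ * g * (p * edgeElt Γ a) =
      (edgeElt Γ a)⁻¹ * (p⁻¹ * g * p) * edgeElt Γ a := by group
  have e2 : Shortens g (halfSpace p a) ↔ Shortens (p⁻¹ * g * p) (halfSpace 1 a) := by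
    constructor
    · intro h q hq
      have := h (p * q) (by rwa [mem_halfSpace, inv_mul_cancel_left, ← one_mul q, ← inv_one])
      rw [mem_halfSpace] at this ⊢
      simpa [mul_assoc] using this
    · intro h q hq
      have := h (p⁻¹ * q) (by rwa [mem_halfSpace, inv_one, one_mul])
      rw [mem_halfSpace] at this ⊢
      simpa [mul_assoc] using this
  rw [e1, e2]
  exact ⟨len_conj_of_shortens, shortens_of_len_conj⟩

/-- A half-space that does not contain the base point is contained in the half-space of some
letter. -/
theorem exists_halfSpace_subset : ∀ (n : ℕ) {p : Artin Γ} {b : V × Bool}, len p = n →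
    (1 : Artin Γ) ∉ halfSpace p b → ∃ a, halfSpace p b ⊆ halfSpace 1 a := by
  intro n
  induction n with
  | zero =>
    intro p b hp _
    rw [eq_one_of_len_eq_zero hp]
    exact ⟨b, subset_rfl⟩
  | succ n ih =>
    intro p b hp h1
    rw [mem_halfSpace, mul_one] at h1
    by_cases he : ∃ e, Leads e p⁻¹ ∧ Γ.Adj b.1 e.1
    · obtain ⟨e, he, hadj⟩ := he
      have hl := he.len_inv_mul
      rw [len_inv, ← len_inv, mul_inv_rev, inv_inv, inv_inv] at hl
      have hsub : halfSpace p b = halfSpace (p * edgeElt Γ e) b := by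
        ext q
        rw [mem_halfSpace, mem_halfSpace, mul_inv_rev, mul_assoc, leads_inv_mul_adj hadj]
      rw [hsub]
      refine ih (by omega) ?_
      rwa [← hsub, mem_halfSpace, mul_one]
    -- No last letter of p commutes past the wall any more, so p · (p⁻¹ q) has no cancellation for q
    -- in the half-space, and any first letter of p leads q.
    · obtain ⟨a, ha⟩ := exists_leads (g := p) (by rintro rfl; simp at hp)
      refine ⟨a, fun q hq => ?_⟩
      have hl := (len_inv_mul_of_forall _ (p := p⁻¹) (q := p⁻¹ * q) rfl (by
        intro d hd hd'
        by_cases hbd : b = d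
        · subst hbd
          exact h1 hd
        · exact Leads.not_leads hq hbd (fun hadj => he ⟨d, hd, hadj⟩) hd')).1
      rw [inv_inv, len_inv] at hl
      have := ha.mul_of_len hl
      rwa [mul_inv_cancel_left, ← one_mul q, ← inv_one] at this

/-- A local minimum is global: a shortening step along a geodesic away from 1 shortens a half-space
lying in that of some letter a at 1, and `Shortens` passes to larger sets. -/
theorem len_le_len_conj {g : Artin Γ} (hg : ∀ a, ¬ Shortens g (halfSpace 1 a)) :
    ∀ (n : ℕ) {p : Artin Γ}, len p = n → len g ≤ len (p⁻¹ * g * p) := by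
  intro n
  induction n with
  | zero =>
    intro p hp
    rw [eq_one_of_len_eq_zero hp]
    simp
  | succ n ih =>
    intro p hp
    obtain ⟨b, hb⟩ := exists_leads (g := p⁻¹) (by
      intro h
      rw [inv_eq_one] at h
      simp [h] at hp)
    obtain ⟨k, rfl⟩ : ∃ k, p = k * edgeElt Γ (rev b) := ⟨p * edgeElt Γ b, by simp [edgeElt_rev]⟩
    have hl := hb.len_inv_mul
    rw [len_inv, ← len_inv] at hl
    have e : ((edgeElt Γ b)⁻¹ * (k * edgeElt Γ (rev b))⁻¹)⁻¹ = k := by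
      rw [edgeElt_rev]
      group
    rw [e] at hl
    have h1 := ih (p := k) (by omega)
    by_contra hlt
    have h2 : Shortens g (halfSpace k (rev b)) := by
      rw [shortens_halfSpace_iff]
      have := len_conj_cases (rev b) (k⁻¹ * g * k)
      have e : (edgeElt Γ (rev b))⁻¹ * (k⁻¹ * g * k) * edgeElt Γ (rev b) =
        (k * edgeElt Γ (rev b))⁻¹ * g * (k * edgeElt Γ (rev b)) := by group
      rw [e] at this
      omega
    obtain ⟨a, ha⟩ := exists_halfSpace_subset _ (p := k) (b := rev b) rfl (by
      rw [mem_halfSpace, mul_one]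
      rw [mul_inv_rev] at hb
      rw [← edgeElt_rev, rev_rev, leads_mul_self] at hb
      exact hb)
    exact hg a (h2.mono ha)

/-- Greedy descent: conjugate by shortening letters as long as there are any; each wall between
start and end is crossed at such a step. -/
theorem exists_minimal_conj : ∀ (n : ℕ) (g p : Artin Γ), len (p⁻¹ * g * p) < n →
    ∃ u, (∀ a, ¬ Shortens g (halfSpace (p * u) a)) ∧ ∀ k ∈ separators p (p * u), Shortens g k := by
  intro n
  induction n with
  | zero => exact fun _ _ h => absurd h (Nat.not_lt_zero _)
  | succ n ih =>
    intro g p hn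
    by_cases h : ∃ a, Shortens g (halfSpace p a)
    · obtain ⟨a, ha⟩ := h
      have hl := shortens_halfSpace_iff.1 ha
      obtain ⟨u, hu, hsep⟩ := ih g (p * edgeElt Γ a) (by omega)
      refine ⟨edgeElt Γ a * u, by rwa [← mul_assoc], fun k hk => ?_⟩
      rcases separators_mul_edgeElt_mul_subset p u a hk with rfl | hk
      · exact ha
      · exact hsep k hk
    · refine ⟨1, by simpa using h, ?_⟩
      rintro k ⟨-, h1, h2⟩
      rw [mul_one] at h2
      exact absurd h2 h1

/-- Every element is conjugate to one of minimal length in its conjugacy class, by an element all of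
whose walls it shortens. -/
theorem exists_conj_le (g : Artin Γ) :
    ∃ u, (∀ p, len (u⁻¹ * g * u) ≤ len (p⁻¹ * g * p)) ∧ (∀ k ∈ separators 1 u, Shortens g k) := by
  obtain ⟨u, hu, hsep⟩ := exists_minimal_conj _ g 1 (Nat.lt_succ_self _)
  rw [one_mul] at hsep
  refine ⟨u, fun p => ?_, hsep⟩
  have := len_le_len_conj (g := u⁻¹ * g * u) (fun a ha => hu a ?_) _ (p := u⁻¹ * p) rfl
  · simpa [mul_assoc] using this
  · rw [one_mul, shortens_halfSpace_iff]
    rw [shortens_halfSpace_iff] at ha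
    simpa [mul_assoc] using ha

end Conj

/-! ### Translation axes -/

section Axis

variable {V : Type*} [Finite V] {Γ : SimpleGraph V}

theorem pow_mul_mem {G : Type*} [Group G] {f : G} {k : Set G} (hf : ∀ q ∈ k, f * q ∈ k) (n : ℕ)
    {q : G} (hq : q ∈ k) : f ^ n * q ∈ k := by
  induction n with
  | zero => simpa using hq
  | succ n ih =>
    rw [pow_succ', mul_assoc]
    exact hf _ ih

/-- Otherwise the strictly nested translates of the half-space by powers of f would be infinitely
many half-spaces separating r from p. -/
theorem exists_pow_notMem {f r q₀ : Artin Γ} {a : V × Bool}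
    (hf : ∀ q ∈ halfSpace r a, f * q ∈ halfSpace r a) (hq₀ : q₀ ∈ halfSpace r a)
    (hq₀' : f⁻¹ * q₀ ∉ halfSpace r a) (p : Artin Γ) : ∃ n : ℕ, (f ^ n)⁻¹ * p ∉ halfSpace r a := by
  by_contra! hall
  refine Set.infinite_of_injective_forall_mem (f := fun n : ℕ => halfSpace (f ^ n * r) a) ?_ ?_
    (separators_finite r p)
  · have key : ∀ n d : ℕ, halfSpace (f ^ n * r) a ≠ halfSpace (f ^ (n + d + 1) * r) a := by
      intro n d h
      have h1 : f ^ n * q₀ ∈ halfSpace (f ^ n * r) a := mul_mem_halfSpace_mul.2 hq₀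
      rw [h, mem_halfSpace_mul] at h1
      refine hq₀' ?_
      have h2 := pow_mul_mem hf d h1
      have e : f ^ d * ((f ^ (n + d + 1))⁻¹ * (f ^ n * q₀)) = f⁻¹ * q₀ := by
        rw [show n + d + 1 = (n + 1) + d by ring, pow_add, pow_succ]
        simp only [mul_inv_rev, mul_assoc, mul_inv_cancel_left, inv_mul_cancel_left]
      rwa [e] at h2
    intro n m hnm
    rcases lt_trichotomy n m with h | h | h
    · obtain ⟨d, rfl⟩ := Nat.exists_eq_add_of_lt h
      exact absurd hnm (key n d)
    · exact h
    · obtain ⟨d, rfl⟩ := Nat.exists_eq_add_of_lt h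
      exact absurd hnm.symm (key m d)
  · refine fun n => ⟨⟨_, _, rfl⟩, fun h => ?_, mem_halfSpace_mul.2 (hall n)⟩
    rw [mem_halfSpace_mul] at h
    have := pow_mul_mem hf n h
    rw [mul_inv_cancel_left] at this
    exact self_notMem_halfSpace r a this

/-- Orbits leave the half-space under negative powers and, by the same argument for f⁻¹ and the
complement, enter it under positive ones. -/
theorem exists_zpow_crossing {f r q₀ : Artin Γ} {a : V × Bool} {k : Set (Artin Γ)}
    (hk : k ⊆ halfSpace r a) (hf : ∀ q ∈ halfSpace r a, f * q ∈ k) (hq₀ : q₀ ∈ halfSpace r a)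
    (hq₀' : f⁻¹ * q₀ ∉ halfSpace r a) (p : Artin Γ) :
    ∃ i : ℤ, f ^ i * p ∉ k ∧ f ^ (i + 1) * p ∈ k := by
  obtain ⟨n, hn⟩ := exists_pow_notMem (fun q hq => hk (hf q hq)) hq₀ hq₀' p
  obtain ⟨m, hm⟩ := exists_pow_notMem (f := f⁻¹) (r := r * edgeElt Γ a) (a := rev a)
    (q₀ := f⁻¹ * q₀) (fun q hq => by
      rw [mem_halfSpace_rev] at hq ⊢
      intro h
      have := hk (hf _ h)
      rw [mul_inv_cancel_left] at this
      exact hq this)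
    (mem_halfSpace_rev.2 hq₀') (by
      rw [inv_inv, mul_inv_cancel_left, mem_halfSpace_rev, not_not]
      exact hq₀) p
  rw [mem_halfSpace_rev, not_not, inv_pow, inv_inv] at hm
  by_contra! hall
  have key : ∀ j : ℕ, f ^ (-(n : ℤ) + j) * p ∉ k := by
    intro j
    induction j with
    | zero =>
      intro h
      refine hn (hk ?_)
      simpa using h
    | succ j ih =>
      have := hall _ ih
      rwa [add_assoc] at this
  -- Starting at exponent -n, this many steps reach m + 1; the extra one moves the orbit from the
  -- half-space into k.
  refine key (n + m + 1) ?_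
  have := hf _ hm
  rw [← mul_assoc, ← pow_succ'] at this
  have e : (-(n : ℤ) + ((n + m + 1 : ℕ) : ℤ)) = ((m + 1 : ℕ) : ℤ) := by
    push_cast
    ring
  rwa [e, zpow_natCast]

/-- If the half-space and its g-translate were disjoint, g would exchange the two sides of a wall;
but opposite sides carry inverse letters, and translation preserves letters. -/
theorem Shortens.exists_mem {g r : Artin Γ} {b : V × Bool} (h : Shortens g (halfSpace r b)) :
    ∃ y ∈ halfSpace r b, g⁻¹ * y ∈ halfSpace r b := by
  by_contra! hall
  have : halfSpace r b = halfSpace (g * (r * edgeElt Γ b)) (rev b) := by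
    ext y
    rw [mem_halfSpace_mul, mem_halfSpace_rev]
    refine ⟨hall y, fun hy => ?_⟩
    have := h _ hy
    rwa [mul_inv_cancel_left] at this
  exact ne_rev b (halfSpace_label this)

variable {g h : Artin Γ} {a : V × Bool}

/-- The map h moves K, the half-space of a, into its complement and g returns that to k, so g h maps
K into k; `Shortens.exists_mem` makes the inclusion in K proper. -/
theorem exists_zpow_crossing_mul (hg : Shortens g (halfSpace 1 a))
    (hh : ∀ q ∈ halfSpace 1 a, h * q ∉ halfSpace 1 a) {k : Set (Artin Γ)}
    (hk : k ⊆ halfSpace 1 a) (hgk : ∀ q, q ∉ halfSpace 1 a → g * q ∈ k) (p : Artin Γ) :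
    ∃ i : ℤ, (g * h) ^ i * p ∉ k ∧ (g * h) ^ (i + 1) * p ∈ k := by
  obtain ⟨y, hy, hy'⟩ := hg.exists_mem
  refine exists_zpow_crossing hk (fun q hq => ?_) hy (fun h' => hh _ h' ?_) p
  · rw [mul_assoc]
    exact hgk _ (hh q hq)
  · rwa [mul_inv_rev, mul_assoc, mul_inv_cancel_left]

/-- If `g` maps the complement of the half-space of `a` into that half-space, and `h` moves the
half-space off itself, then both `a` and its inverse occur in every word for a conjugate of `g h`. -/
theorem mem_word_of_conj (hg : Shortens g (halfSpace 1 a))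
    (hh : ∀ q ∈ halfSpace 1 a, h * q ∉ halfSpace 1 a) {p : Artin Γ} {l : List (V × Bool)}
    (hl : wordElt Γ l = p⁻¹ * (g * h) * p) : a ∈ l ∧ rev a ∈ l := by
  have e : ∀ i : ℤ, (g * h) ^ i * p * wordElt Γ l = (g * h) ^ (i + 1) * p := by
    intro i
    rw [hl, zpow_add_one]
    group
  constructor
  · obtain ⟨i, h1, h2⟩ := exists_zpow_crossing_mul hg hh subset_rfl hg p
    rw [← e] at h2
    exact exists_crossing l h1 h2
  -- The second half-space is the g-translate of the complement of K; it lies in K and carries the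
  -- inverse letter.
  · obtain ⟨i, h1, h2⟩ := exists_zpow_crossing_mul hg hh
      (k := halfSpace (g * (1 * edgeElt Γ a)) (rev a)) (fun q hq => by
        rw [mem_halfSpace_mul, mem_halfSpace_rev] at hq
        have := hg _ hq
        rwa [mul_inv_cancel_left] at this) (fun q hq => by
        rw [mul_mem_halfSpace_mul, mem_halfSpace_rev]
        exact hq) p
    rw [← e] at h2
    exact exists_crossing l h1 h2

/-- The orbit of p under g h enters each such k. Pulling the crossing back by the relevant power
gives a half-space separating p from g h p, and different k give different ones. -/
theorem ncard_separators_subset_le (hg : Shortens g (halfSpace 1 a))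
    (hh : ∀ q ∈ halfSpace 1 a, h * q ∉ halfSpace 1 a) {u : Artin Γ}
    (hu : ∀ k ∈ separators 1 u, Shortens g k) (p : Artin Γ) :
    {k ∈ separators 1 u | k ⊆ halfSpace 1 a}.ncard ≤ len (p⁻¹ * (g * h) * p) := by
  have hex : ∀ k, k ∈ {k ∈ separators 1 u | k ⊆ halfSpace 1 a} →
      ∃ i : ℤ, (g * h) ^ i * p ∉ k ∧ (g * h) ^ (i + 1) * p ∈ k := fun k hk =>
    exists_zpow_crossing_mul hg hh hk.2 (fun q hq => hu k hk.1 q fun h' => hq (hk.2 h')) p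
  choose! i hi using hex
  -- No positive power of g h can relate two of these half-spaces: take y and g⁻¹ y both in k'; the
  -- pull-back of y would lie in K, and following it forward through h puts g⁻¹ y outside K.
  have key : ∀ k ∈ {k ∈ separators 1 u | k ⊆ halfSpace 1 a},
      ∀ k' ∈ {k ∈ separators 1 u | k ⊆ halfSpace 1 a}, ∀ d : ℕ,
      (∀ x, (g * h) ^ (d + 1) * x ∈ k' → x ∈ k) → False := by
    rintro k hk k' hk' d hd
    obtain ⟨⟨⟨r, b, rfl⟩, -, -⟩, hsub⟩ := id hk'
    obtain ⟨y, hy, hy'⟩ := (hu _ hk'.1).exists_mem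
    have h1 := hk.2 (hd (((g * h) ^ (d + 1))⁻¹ * y) (by rwa [mul_inv_cancel_left]))
    have h2 := pow_mul_mem (f := g * h) (fun q hq => by
      rw [mul_assoc]
      exact hg _ (hh q hq)) d h1
    have h3 := hh _ h2
    have e : h * ((g * h) ^ d * (((g * h) ^ (d + 1))⁻¹ * y)) = g⁻¹ * y := by
      rw [pow_succ']
      generalize (g * h) ^ d = z
      have : z * (g * h * z)⁻¹ = (g * h)⁻¹ := by group
      rw [← mul_assoc z, this]
      group
    rw [e] at h3
    exact h3 (hsub hy')
  refine le_trans ?_ ((ncard_separators_le p (g * h * p)).trans_eq (by rw [← mul_assoc]))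
  refine Set.ncard_le_ncard_of_injOn (fun k => {q | (g * h) ^ i k * q ∈ k}) ?_ ?_
    (separators_finite _ _)
  · rintro k hk
    obtain ⟨h1, h2⟩ := hi k hk
    obtain ⟨⟨⟨r, b, rfl⟩, -, -⟩, -⟩ := id hk
    refine ⟨⟨((g * h) ^ i (halfSpace r b))⁻¹ * r, b, ?_⟩, h1, ?_⟩
    · ext q
      rw [mem_halfSpace_mul, inv_inv]
      rfl
    · rw [zpow_add_one, mul_assoc] at h2
      exact h2
  · intro k hk k' hk' heq
    have hmem : ∀ x, (g * h) ^ i k * x ∈ k ↔ (g * h) ^ i k' * x ∈ k' := fun x =>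
      Set.ext_iff.1 heq x
    rcases lt_trichotomy (i k) (i k') with hlt | heq' | hlt
    · obtain ⟨d, hd⟩ := Int.le.dest (Int.add_one_le_of_lt hlt)
      refine (key k hk k' hk' d fun x hx => ?_).elim
      have := (hmem (((g * h) ^ i k)⁻¹ * x)).2 (by
        rw [← hd, ← mul_assoc, ← zpow_neg, ← zpow_add]
        rw [← zpow_natCast] at hx
        convert hx using 3
        push_cast
        ring)
      rwa [mul_inv_cancel_left] at this
    · ext x
      have := hmem (((g * h) ^ i k)⁻¹ * x)
      rwa [← heq', mul_inv_cancel_left] at this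
    · obtain ⟨d, hd⟩ := Int.le.dest (Int.add_one_le_of_lt hlt)
      refine (key k' hk' k hk d fun x hx => ?_).elim
      have := (hmem (((g * h) ^ i k')⁻¹ * x)).1 (by
        rw [← hd, ← mul_assoc, ← zpow_neg, ← zpow_add]
        rw [← zpow_natCast] at hx
        convert hx using 3
        push_cast
        ring)
      rwa [mul_inv_cancel_left] at this

end Axis

/-! ### Automorphisms that are balanced at the base point -/

section Balanced

variable {V : Type*} {Γ : SimpleGraph V}

theorem conjLength_mk_wordElt_le (l : List (V × Bool)) :
    conjLength Γ (ConjClasses.mk (wordElt Γ l)) ≤ l.length := by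
  classical
  have h : conjLength Γ (ConjClasses.mk (wordElt Γ l)) ≤ FreeGroup.norm (FreeGroup.mk l) := by
    refine Nat.sInf_le ⟨FreeGroup.mk l, ?_, by congr!⟩
    rw [mk_eq_prod]
    rfl
  exact h.trans FreeGroup.norm_mk_le

theorem mk_wordElt_mem_shortClasses {l : List (V × Bool)} (hl : l.length ≤ 2) :
    ConjClasses.mk (wordElt Γ l) ∈ shortClasses Γ := by
  classical
  refine ⟨FreeGroup.mk l, ?_, ?_⟩
  · refine le_trans ?_ hl
    convert FreeGroup.norm_mk_le (L₁ := l)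
  · rw [mk_eq_prod]
    rfl

theorem exists_word_conj (g : Artin Γ) : ∃ (p : Artin Γ) (l : List (V × Bool)),
    wordElt Γ l = p⁻¹ * g * p ∧ l.length ≤ conjLength Γ (ConjClasses.mk g) := by
  classical
  obtain ⟨w, hw, hn⟩ := Nat.sInf_mem (conjLength_nonempty Γ (ConjClasses.mk g))
  rw [ConjClasses.mk_eq_mk_iff_isConj, isConj_comm, isConj_iff] at hw
  obtain ⟨c, hc⟩ := hw
  refine ⟨c⁻¹, w.toWord, ?_, ?_⟩
  · rw [inv_inv, hc, wordElt, ← mk_eq_prod, FreeGroup.mk_toWord]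
  · refine le_of_eq (Eq.trans ?_ hn)
    unfold FreeGroup.norm
    congr!

theorem exists_len_conj_le (g : Artin Γ) :
    ∃ p, len (p⁻¹ * g * p) ≤ conjLength Γ (ConjClasses.mk g) := by
  obtain ⟨p, l, hl, hlen⟩ := exists_word_conj g
  exact ⟨p, hl ▸ (len_wordElt_le l).trans hlen⟩

theorem mulAut_ext {φ ψ : MulAut (Artin Γ)} (h : ∀ v, φ (gen Γ v) = ψ (gen Γ v)) : φ = ψ := by
  have : φ.toMonoidHom = ψ.toMonoidHom := PresentedGroup.ext h
  exact MulEquiv.ext fun g => DFunLike.congr_fun this g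

/-- A family of elements is balanced if no letter by which a conjugation shortens a member of the
family can be used without lengthening another member. -/
def Balanced [Finite V] {ι : Type*} (g : ι → Artin Γ) : Prop :=
  ∀ a x, Shortens (g x) (halfSpace 1 a) →
    ∃ y, ∀ q ∈ halfSpace 1 a, g y * q ∉ halfSpace 1 a

variable [Finite V]

/-- Minimize the total length over simultaneous conjugations. A shortening letter that lengthens no
member would lower the total. -/
theorem exists_balanced {ι : Type*} [Finite ι] (g : ι → Artin Γ) :
    ∃ p, Balanced fun x => p⁻¹ * g x * p := by
  cases nonempty_fintype ι
  obtain ⟨p, -, hp⟩ := WellFounded.has_min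
    (measure fun p : Artin Γ => ∑ x, len (p⁻¹ * g x * p)).wf Set.univ Set.univ_nonempty
  refine ⟨p, fun a x hx => ?_⟩
  by_contra hall
  refine hp (p * edgeElt Γ a) trivial (show
    ∑ x, len ((p * edgeElt Γ a)⁻¹ * g x * (p * edgeElt Γ a)) <
    ∑ x, len (p⁻¹ * g x * p) from Finset.sum_lt_sum (fun y _ => ?_) 
    ⟨x, Finset.mem_univ _, ?_⟩)
  · have e : (p * edgeElt Γ a)⁻¹ * g y * (p * edgeElt Γ a) =
        (edgeElt Γ a)⁻¹ * (p⁻¹ * g y * p) * edgeElt Γ a := by group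
    rw [e]
    rcases len_conj_cases a (p⁻¹ * g y * p) with h | h | h
    · omega
    · omega
    · refine absurd ⟨y, fun q hq hq' => ?_⟩ hall
      rw [mem_halfSpace, inv_one, one_mul] at hq hq'
      exact not_leads_mul_of_gain h hq hq'
  · have e : (p * edgeElt Γ a)⁻¹ * g x * (p * edgeElt Γ a) =
        (edgeElt Γ a)⁻¹ * (p⁻¹ * g x * p) * edgeElt Γ a := by group
    rw [e]
    have : _ = len (p⁻¹ * g x * p) := len_conj_of_shortens hx
    omega

/-- Let u conjugate g x to a shortest form. The half-spaces between 1 and u are sorted by a letter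
whose half-space at 1 contains them. Each nonempty class belongs to a shortening letter, so balance
supplies y, and g x * g y bounds the class by N. Thus u has length at most |V^±| N, and it is used
on both sides. -/
theorem Balanced.len_le {ι : Type*} {g : ι → Artin Γ} (hg : Balanced g) {N : ℕ}
    (h1 : ∀ x, conjLength Γ (ConjClasses.mk (g x)) ≤ N)
    (h2 : ∀ x y, conjLength Γ (ConjClasses.mk (g x * g y)) ≤ N) (x : ι) :
    len (g x) ≤ 2 * (Nat.card (V × Bool) * N) + N := by
  cases nonempty_fintype (V × Bool)
  obtain ⟨u, hmin, hu⟩ := exists_conj_le (g x)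
  obtain ⟨p, hp⟩ := exists_len_conj_le (g x)
  have hc := (hmin p).trans (hp.trans (h1 x))
  have hlen : len u ≤ Nat.card (V × Bool) * N := by
    have h3 := len_le_ncard_separators _ 1 (u := u) rfl
    rw [one_mul] at h3
    have hcover : separators 1 u ⊆ ⋃ a ∈ (Finset.univ : Finset (V × Bool)),
        {k ∈ separators 1 u | k ⊆ halfSpace 1 a} := by
      intro k hk
      obtain ⟨⟨r, b, rfl⟩, h, -⟩ := id hk
      obtain ⟨a, ha⟩ := exists_halfSpace_subset _ rfl h
      simp only [Finset.mem_univ, Set.iUnion_true, Set.mem_iUnion]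
      exact ⟨a, hk, ha⟩
    have hfin : (⋃ a ∈ (Finset.univ : Finset (V × Bool)),
        {k ∈ separators 1 u | k ⊆ halfSpace 1 a}).Finite :=
      (separators_finite 1 u).subset (Set.iUnion₂_subset fun _ _ => Set.sep_subset _ _)
    refine h3.trans ((Set.ncard_le_ncard hcover hfin).trans
      ((Finset.set_ncard_biUnion_le _ _).trans ?_))
    rw [Nat.card_eq_fintype_card, ← Finset.card_univ, ← smul_eq_mul]
    refine Finset.sum_le_card_nsmul _ _ _ fun a _ => ?_
    rcases Set.eq_empty_or_nonempty {k ∈ separators 1 u | k ⊆ halfSpace 1 a} with he | ⟨k, hk, hka⟩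
    · rw [he, Set.ncard_empty]
      exact Nat.zero_le _
    · have hxa := (hu k hk).mono hka
      obtain ⟨y, hy⟩ := hg a x hxa
      obtain ⟨p, hp⟩ := exists_len_conj_le (g x * g y)
      exact (ncard_separators_subset_le hxa hy hu p).trans (hp.trans (h2 x y))
  have e : g x = u * (u⁻¹ * g x * u) * u⁻¹ := by group
  have b1 := len_mul_le (u * (u⁻¹ * g x * u)) u⁻¹
  have b2 := len_mul_le u (u⁻¹ * g x * u)
  rw [← e, len_inv] at b1
  omega

/-- If a shortened g x, balance would give y such that every word for a conjugate of g x * g y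
contains a and its inverse. A word of length at most 2 with this property is trivial. -/
theorem Balanced.len_le_one {ι : Type*} {g : ι → Artin Γ} (hg : Balanced g)
    (h1 : ∀ x, conjLength Γ (ConjClasses.mk (g x)) ≤ 1)
    (h2 : ∀ x y, conjLength Γ (ConjClasses.mk (g x * g y)) ≤ 2)
    (h3 : ∀ x y, g x * g y ≠ 1) (x : ι) : len (g x) ≤ 1 := by
  obtain ⟨p, hp⟩ := exists_len_conj_le (g x)
  refine (len_le_len_conj (fun a ha => ?_) _ rfl).trans (hp.trans (h1 x))
  obtain ⟨y, hy⟩ := hg a x ha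
  obtain ⟨p, l, hl, hlen⟩ := exists_word_conj (g x * g y)
  obtain ⟨m1, m2⟩ := mem_word_of_conj ha hy hl
  replace hlen := hlen.trans (h2 x y)
  have hone : wordElt Γ l = 1 := by
    have hne := ne_rev a
    match l, hlen, m1, m2 with
    | [], _, m1, _ => simp at m1
    | [b], _, m1, m2 =>
      rw [List.mem_singleton] at m1 m2
      exact absurd (m1.trans m2.symm) hne
    | [b, c], _, m1, m2 =>
      simp only [List.mem_cons, List.not_mem_nil, or_false] at m1 m2
      rcases m1 with rfl | rfl <;> rcases m2 with m2 | m2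
      · exact absurd m2.symm hne
      · simp [← m2, edgeElt_rev]
      · simp [← m2, edgeElt_rev]
      · exact absurd m2.symm hne
  refine h3 x y ?_
  rw [hone] at hl
  have : g x * g y = p * (p⁻¹ * (g x * g y) * p) * p⁻¹ := by group
  rw [this, ← hl]
  group

theorem exists_balanced_mulAut (φ : MulAut (Artin Γ)) : ∃ ψ : MulAut (Artin Γ),
    (ψ : Out (Artin Γ)) = φ ∧ (∀ g, ConjClasses.mk (ψ g) = ConjClasses.mk (φ g)) ∧
      Balanced fun v => ψ (gen Γ v) := by
  obtain ⟨p, hp⟩ := exists_balanced fun v => φ (gen Γ v)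
  have e : ∀ g, ((MulAut.conj p)⁻¹ * φ) g = p⁻¹ * φ g * p := fun g => by
    rw [MulAut.mul_apply, MulAut.conj_inv_apply]
  refine ⟨(MulAut.conj p)⁻¹ * φ, ?_, fun g => ?_, ?_⟩
  · rw [QuotientGroup.mk_mul, QuotientGroup.mk_inv,
      (QuotientGroup.eq_one_iff (N := Inn (Artin Γ)) (MulAut.conj p)).2
        (MonoidHom.mem_range.2 ⟨p, rfl⟩), inv_one, one_mul]
  · rw [e, ConjClasses.mk_eq_mk_iff_isConj, isConj_iff]
    exact ⟨p, by group⟩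
  · simpa only [e] using hp

theorem finite_len_le (C : ℕ) : {g : Artin Γ | len g ≤ C}.Finite := by
  refine ((List.finite_length_le (V × Bool) C).image (wordElt Γ)).subset fun g hg => ?_
  obtain ⟨l, hl, hlen⟩ := exists_geodesic g
  exact ⟨l, hlen.trans_le hg, hl⟩

theorem finite_mulAut_len_le (C : ℕ) :
    {ψ : MulAut (Artin Γ) | ∀ v, len (ψ (gen Γ v)) ≤ C}.Finite := by
  refine Set.Finite.of_finite_image (f := fun ψ : MulAut (Artin Γ) => fun v => ψ (gen Γ v)) ?_
    fun φ _ ψ _ h => mulAut_ext fun v => congrFun h v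
  refine (Set.Finite.pi' (t := fun _ : V => {g : Artin Γ | len g ≤ C})
    fun _ => finite_len_le C).subset ?_
  rintro _ ⟨ψ, hψ, rfl⟩
  exact hψ

end Balanced

/-! ### Automorphisms that preserve the length of all conjugacy classes -/

section Rigid

variable {V : Type*} [Finite V] {Γ : SimpleGraph V}

theorem gen_mul_gen_ne_one (v w : V) : gen Γ v * gen Γ w ≠ 1 := by
  intro h
  refine not_leads_one (Γ := Γ) (v, true) ?_
  rw [← h, ← edgeElt_true, leads_mul_self, ← edgeElt_true, leads_edgeElt]
  simp [rev]

theorem commute_edgeElt_iff {a b : V × Bool} :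
    Commute (edgeElt Γ a) (edgeElt Γ b) ↔ Γ.Adj a.1 b.1 ∨ a.1 = b.1 := by
  constructor
  · intro h
    by_contra! hab
    have hne : a ≠ b := fun e => hab.2 (e ▸ rfl)
    have h1 : Leads a (edgeElt Γ a * edgeElt Γ b) := by
      rw [leads_mul_self, leads_edgeElt]
      intro e
      exact hab.2 (show (rev a).1 = b.1 from congrArg Prod.fst e)
    refine h1.not_leads hne hab.1 ?_
    rw [h.eq, leads_mul_self, leads_edgeElt]
    intro e
    exact hab.2 (show (rev b).1 = a.1 from congrArg Prod.fst e).symm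
  · rintro (h | h)
    · exact edgeElt_commute Γ h
    · obtain ⟨v, s⟩ := a
      obtain ⟨w, t⟩ := b
      obtain rfl : v = w := h
      have e : edgeElt Γ (v, false) = (edgeElt Γ (v, true))⁻¹ := edgeElt_rev Γ (v, true)
      cases s <;> cases t <;> simp [e]

theorem fst_eq_iff {a b : V × Bool} :
    a.1 = b.1 ↔ edgeElt Γ a = edgeElt Γ b ∨ edgeElt Γ a = (edgeElt Γ b)⁻¹ := by
  rw [← edgeElt_rev, edgeElt_injective.eq_iff, edgeElt_injective.eq_iff]
  obtain ⟨v, s⟩ := a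
  obtain ⟨w, t⟩ := b
  cases s <;> cases t <;> simp [rev]

/-- An automorphism that carries generators to letters is induced by an isomorphism of the Salvetti
complex. -/
theorem exists_indAut_eq {ψ : MulAut (Artin Γ)} (h : ∀ v, ∃ b, ψ (gen Γ v) = edgeElt Γ b) :
    ∃ k : SalvettiAut Γ, indAut Γ k = ψ := by
  have h' : ∀ a, ∃ b, ψ (edgeElt Γ a) = edgeElt Γ b := by
    rintro ⟨v, s⟩
    obtain ⟨b, hb⟩ := h v
    cases s
    · refine ⟨rev b, ?_⟩
      rw [edgeElt_rev, ← hb, ← edgeElt_true, ← map_inv, ← edgeElt_rev]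
      rfl
    · exact ⟨b, hb⟩
  choose f hf using h'
  have hinj : Function.Injective f := fun a b hab => by
    have := (hf a).trans ((congrArg _ hab).trans (hf b).symm)
    exact edgeElt_injective (ψ.injective this)
  have hadj : ∀ a b, Γ.Adj (f a).1 (f b).1 ↔ Γ.Adj a.1 b.1 := by
    have key : ∀ a b : V × Bool, Γ.Adj a.1 b.1 ↔
        Commute (edgeElt Γ a) (edgeElt Γ b) ∧ ¬ a.1 = b.1 := fun a b => by
      rw [commute_edgeElt_iff]
      exact ⟨fun h => ⟨Or.inl h, h.ne⟩, fun h => h.1.resolve_right h.2⟩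
    intro a b
    -- Adjacency is expressed purely in the group: the letters commute but are neither equal nor
    -- inverse.
    rw [key, key, fst_eq_iff (Γ := Γ), fst_eq_iff (Γ := Γ), ← hf, ← hf, ← map_inv,
      ψ.injective.eq_iff, ψ.injective.eq_iff]
    refine and_congr_left fun _ => ⟨fun h => ?_, fun h => h.map ψ⟩
    simpa using h.map (ψ⁻¹ : MulAut (Artin Γ))
  let F : Equiv.Perm (V × Bool) := Equiv.ofBijective f (Finite.injective_iff_bijective.1 hinj)
  refine ⟨⟨F, fun a => ?_, fun s => ?_⟩, mulAut_ext fun v => ?_⟩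
  · apply edgeElt_injective (Γ := Γ)
    change edgeElt Γ (f (rev a)) = edgeElt Γ (rev (f a))
    rw [edgeElt_rev, ← hf, ← hf, edgeElt_rev, map_inv]
  · rw [SpansCube, SpansCube]
    change (f '' s).Pairwise _ ↔ _
    rw [hinj.injOn.pairwise_image]
    simp only [Set.Pairwise, Function.onFun, hadj]
  · rw [← edgeElt_true, hf]
    exact indHom_edgeElt Γ ⟨F, _⟩ (v, true)

theorem exists_indAut_of_conjLength {φ : MulAut (Artin Γ)}
    (h : ∀ g, conjLength Γ (ConjClasses.mk (φ g)) = conjLength Γ (ConjClasses.mk g)) :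
    ∃ k : SalvettiAut Γ, (indAut Γ k : Out (Artin Γ)) = φ := by
  obtain ⟨ψ, hψ, hconj, hbal⟩ := exists_balanced_mulAut φ
  suffices ∀ v, ∃ b, ψ (gen Γ v) = edgeElt Γ b by
    obtain ⟨k, hk⟩ := exists_indAut_eq this
    exact ⟨k, by rw [hk, hψ]⟩
  intro v
  have hlen := hbal.len_le_one (fun x => by
      rw [hconj, h]
      simpa [edgeElt_true] using conjLength_mk_wordElt_le (Γ := Γ) [(x, true)])
    (fun x y => by
      rw [← map_mul, hconj, h]
      simpa [edgeElt_true] using conjLength_mk_wordElt_le (Γ := Γ) [(x, true), (y, true)])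
    (fun x y => by
      rw [← map_mul, Ne, map_eq_one_iff ψ ψ.injective]
      exact gen_mul_gen_ne_one x y) v
  obtain ⟨l, hl, hll⟩ := exists_geodesic (ψ (gen Γ v))
  rw [← hll] at hlen
  match l, hlen, hl with
  | [], _, hl =>
    rw [wordElt_nil, eq_comm, map_eq_one_iff ψ ψ.injective] at hl
    exact absurd (by rw [hl, one_mul]) (gen_mul_gen_ne_one (Γ := Γ) v v)
  | [b], _, hl => exact ⟨b, by simpa using hl.symm⟩

end Rigid

/-! ### The norm -/

section Norm

variable {V : Type*} [Finite V] {Γ : SimpleGraph V}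

theorem MarkedSalvetti.len_le_norm0 (σ : MarkedSalvetti Γ) {g : ConjClasses (Artin Γ)}
    (hg : g ∈ shortClasses Γ) : (σ.len g : ℤ) ≤ σ.norm0 :=
  Finset.single_le_sum (f := fun g => (σ.len g : ℤ)) (fun _ _ => Int.natCast_nonneg _)
    ((shortClasses_finite Γ).mem_toFinset.2 hg)

/-- The bound controls conjugacy lengths under α⁻¹, so it is α⁻¹ that is represented by a balanced
automorphism; only finitely many are possible. -/
theorem finite_norm0_le (N : ℤ) : {σ : MarkedSalvetti Γ | σ.norm0 ≤ N}.Finite := by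
  set C := 2 * (Nat.card (V × Bool) * N.toNat) + N.toNat
  have hfin : {α : OutL Γ | (α : Out (Artin Γ)) ∈ (fun ψ : MulAut (Artin Γ) =>
      ((ψ : Out (Artin Γ)))⁻¹) '' {ψ | ∀ v, len (ψ (gen Γ v)) ≤ C}}.Finite :=
    ((finite_mulAut_len_le C).image _).preimage Subtype.val_injective.injOn
  refine (hfin.image (Quotient.mk (markingSetoid Γ))).subset fun σ hσ => ?_
  induction σ using Quotient.inductionOn with | _ α
  obtain ⟨φ, hφ⟩ := QuotientGroup.mk_surjective ((α : Out (Artin Γ))⁻¹)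
  obtain ⟨ψ, hψ, hconj, hbal⟩ := exists_balanced_mulAut φ
  have key : ∀ l : List (V × Bool), l.length ≤ 2 →
      conjLength Γ (ConjClasses.mk (ψ (wordElt Γ l))) ≤ N.toNat := by
    intro l hl
    have h1 := (MarkedSalvetti.len_le_norm0 (⟦α⟧ : MarkedSalvetti Γ)
      (mk_wordElt_mem_shortClasses hl)).trans hσ
    have h2 : MarkedSalvetti.len (⟦α⟧ : MarkedSalvetti Γ) (ConjClasses.mk (wordElt Γ l)) =
        conjLength Γ (ConjClasses.mk (φ (wordElt Γ l))) := by
      change conjLength Γ (outConj (Artin Γ) (α : Out (Artin Γ))⁻¹ _) = _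
      rw [← hφ]
      rfl
    rw [hconj, ← h2]
    omega
  refine ⟨α, ⟨ψ, hbal.len_le (fun x => ?_) fun x y => ?_, ?_⟩, rfl⟩
  · simpa [edgeElt_true] using key [(x, true)] (by simp)
  · simpa [edgeElt_true] using key [(x, true), (y, true)] (by simp)
  · change ((ψ : Out (Artin Γ)))⁻¹ = _
    rw [hψ, hφ, inv_inv]

/-- Equal length functions make β⁻¹ α preserve all conjugacy lengths, so it is a Salvetti
isomorphism relating the markings. -/
theorem MarkedSalvetti.len_injective :
    Function.Injective (MarkedSalvetti.len : MarkedSalvetti Γ → _ → ℕ) := by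
  intro σ τ h
  induction σ using Quotient.inductionOn with | _ α
  induction τ using Quotient.inductionOn with | _ β
  obtain ⟨φ, hφ⟩ := QuotientGroup.mk_surjective (α : Out (Artin Γ))
  obtain ⟨ψ, hψ⟩ := QuotientGroup.mk_surjective (β : Out (Artin Γ))
  have hlen : ∀ g, conjLength Γ (ConjClasses.mk (φ⁻¹ g)) =
      conjLength Γ (ConjClasses.mk (ψ⁻¹ g)) := by
    intro g
    have := congrFun h (ConjClasses.mk g)
    change conjLength Γ (outConj (Artin Γ) (α : Out (Artin Γ))⁻¹ _) =
      conjLength Γ (outConj (Artin Γ) (β : Out (Artin Γ))⁻¹ _) at this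
    rwa [← hφ, ← hψ, ← QuotientGroup.mk_inv, ← QuotientGroup.mk_inv] at this
  obtain ⟨k, hk⟩ := exists_indAut_of_conjLength (φ := ψ⁻¹ * φ) fun g => by
    rw [MulAut.mul_apply, ← hlen, MulAut.inv_apply_self]
  refine Quotient.sound ⟨k, ?_⟩
  rw [hk, QuotientGroup.mk_mul, QuotientGroup.mk_inv, hψ, hφ, mul_inv_cancel_left]

theorem MarkedSalvetti.norm_injective {e : ℕ → ConjClasses (Artin Γ)}
    (he : Function.Surjective e) :
    Function.Injective (MarkedSalvetti.norm e : MarkedSalvetti Γ → _) := by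
  intro σ τ h
  have h' : (fun i => (σ.len (e i) : ℤ)) = fun i => (τ.len (e i) : ℤ) :=
    congrArg (fun x : ℤ ×ₗ Lex (ℕ → ℤ) => ofLex (ofLex x).2) h
  refine MarkedSalvetti.len_injective (funext fun g => ?_)
  obtain ⟨i, rfl⟩ := he g
  exact_mod_cast congrFun h' i

end Norm

end RAAG

theorem mainTheorem10 {V : Type*} [Finite V] (Γ : SimpleGraph V) :
    (∀ N : ℤ, {σ : RAAG.MarkedSalvetti Γ | σ.norm0 ≤ N}.Finite) ∧
    ∀ e : ℕ → ConjClasses (RAAG.Artin Γ), Function.Surjective e →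
      IsWellOrder (RAAG.MarkedSalvetti Γ) (fun σ τ => σ.norm e < τ.norm e) := by
  refine ⟨RAAG.finite_norm0_le, fun e he => ?_⟩
  have : Std.Trichotomous fun σ τ : RAAG.MarkedSalvetti Γ => σ.norm e < τ.norm e :=
    ⟨fun σ τ h1 h2 => RAAG.MarkedSalvetti.norm_injective he
      (le_antisymm (not_lt.1 h2) (not_lt.1 h1))⟩
  have : IsWellFounded (RAAG.MarkedSalvetti Γ) fun σ τ => σ.norm e < τ.norm e := by
    refine ⟨WellFounded.wellFounded_iff_has_min.2 fun s ⟨σ, hσ⟩ => ?_⟩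
    -- The first coordinate dominates, so a minimum over this finite sublevel set is a minimum over
    -- all of s.
    obtain ⟨τ, hτ, hmin⟩ := Set.exists_min_image (s ∩ {τ | τ.norm0 ≤ σ.norm0})
      (RAAG.MarkedSalvetti.norm e) ((RAAG.finite_norm0_le σ.norm0).inter_of_right s)
      ⟨σ, hσ, le_refl σ.norm0⟩
    refine ⟨τ, hτ.1, fun ρ hρ hlt => (hmin ρ ⟨hρ, ?_⟩).not_gt hlt⟩
    have hle : ρ.norm0 ≤ τ.norm0 := Prod.Lex.monotone_fst (ρ.norm e) (τ.norm e) hlt.le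
    exact hle.trans hτ.2
  exact {}
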